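/- Let $K$ be a field of characteristic zero, let $m,n\ge 0$ and $d,l$ be integers with $1\le l<d$, let $V=K^{m+n}$ with standard basis $e_1,\dots,e_{m+n}$, and let $W=\langle e_1,\dots,e_m\rangle$. Let $G=\operatorname{SL}(V)$, let $P\subseteq G$ be the stabiliser of $W$, and let $X=G/P=\mathbb{G}(m,m+n)$ be the Grassmannian of $m$-planes in $V$, with its Plücker embedding $i:X\to\mathbb{P}(\wedge^mV^*)$ and $\mathcal{O}_X(d)=i^*\mathcal{O}(1)^{\otimes d}$. Let $\mathfrak{g}=\mathfrak{sl}(V)$ be the Lie algebra of $G$, let $U(\mathfrak{g})$ be its universal enveloping algebra, and let $U_l(\mathfrak{g})\subseteq U(\mathfrak{g})$ be the span of the products of at most $l$ elements of $\mathfrak{g}$. Let $\mathfrak{n}\subseteq\mathfrak{g}$ be the subalgebra of the block matrices $\begin{pmatrix}0&0\\Y&0\end{pmatrix}$ with $Y$ an $n\times m$ matrix over $K$. Let $V_\lambda=\mathrm{H}^0(X,\mathcal{O}_X(d))^*$ with its natural action of $\mathfrak{g}$, and let $v\in V_\lambda$ be a highest weight vector, i.e. a nonzero weight vector for the diagonal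 matrices in $\mathfrak{g}$ that is annihilated by the strictly upper triangular matrices. Put $U_l(\mathfrak{g})v=\{x(v):x\in U_l(\mathfrak{g})\}\subseteq V_\lambda$. If $z_1,\dots,z_{mn}$ is a basis of $\mathfrak{n}$, then the vectors $z_1^{v_1}\cdots z_{mn}^{v_{mn}}(v)$, indexed by the tuples $(v_1,\dots,v_{mn})$ of non-negative integers with $\sum_i v_i\le l$, form a basis of the $K$-vector space $U_l(\mathfrak{g})v$. Moreover $$\dim_K U_l(\mathfrak{g})v=\binom{mn+l}{mn}.$$ -/

import Mathlib

/-!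
# Sections of `O_X(d)` on a Grassmannian and the canonical filtration of the dual

Conventions.  `V = K^(m+n)` with standard basis `e_1, ..., e_{m+n}`, `W = <e_1, ..., e_m>`,
`G = SL(V)`, `P` is the stabiliser of `W`, `X = G/P` is the Grassmannian of `m`-planes of `V`,
and `O_X(d)` is the `d`-th power of the pull-back of `O(1)` along the Plücker embedding.
A point of `X` is the column space of an `(m+n) × m` matrix of rank `m` (a frame).
-/

-- The commutator bracket on an associative algebra.
attribute [local instance 100] LieRing.ofAssociativeRing

noncomputable section

namespace GrassmannJet

open MvPolynomial

/-- Polynomial functions on the space of `(m+n) × m` matrices; `X (i, a)` is the `(i, a)` entry. -/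
abbrev FrameRing (K : Type*) [Field K] (m n : ℕ) : Type _ :=
  MvPolynomial (Fin (m + n) × Fin m) K

/-- The Plücker coordinate `p_J`: the minor of the generic `(m+n) × m` matrix with rows
`J 1, ..., J m`.  It is zero if `J` repeats a row, and permuting `J` only changes its sign. -/
def plucker (K : Type*) [Field K] (m n : ℕ) (J : Fin m → Fin (m + n)) : FrameRing K m n :=
  (Matrix.of fun a b : Fin m => (X (J a, b) : FrameRing K m n)).det

/-- The linear span of the Plücker coordinates.  The homogeneous coordinate ring of the Plücker
embedded Grassmannian is `R = ⨁ k, R_k` where `R_k = pluckerSpan ^ k` is spanned by the products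
of `k` Plücker coordinates. -/
def pluckerSpan (K : Type*) [Field K] (m n : ℕ) : Submodule K (FrameRing K m n) :=
  Submodule.span K (Set.range (plucker K m n))

/-- The action of `gl(V)` on functions of a frame `x` that is induced by the action of `GL(V)`,
`(g f)(x) = f(g⁻¹ x)`: the matrix `A` acts as the derivation with `x ↦ - A x`. -/
def frameDer (K : Type*) [Field K] (m n : ℕ) (A : Matrix (Fin (m + n)) (Fin (m + n)) K) :
    Derivation K (FrameRing K m n) (FrameRing K m n) :=
  mkDerivation K fun p => - ∑ k, A p.1 k • (X (k, p.2) : FrameRing K m n)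

section Action

variable {K : Type*} [Field K] {m n : ℕ}

theorem derivation_prod {R ι : Type*} [CommRing R] [Algebra K R] [DecidableEq ι]
    (D : Derivation K R R) (s : Finset ι) (f : ι → R) :
    D (∏ i ∈ s, f i) = ∑ i ∈ s, (∏ j ∈ s.erase i, f j) * D (f i) := by
  induction s using Finset.induction_on with
  | empty => simp
  | insert a s ha ih =>
    rw [Finset.prod_insert ha, Derivation.leibniz, ih, Finset.sum_insert ha,
      Finset.erase_insert ha, smul_eq_mul, smul_eq_mul, Finset.mul_sum, add_comm]
    congr 1
    refine Finset.sum_congr rfl fun i hi => ?_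
    have hne : a ≠ i := fun h => ha (h ▸ hi)
    rw [Finset.erase_insert_of_ne hne, Finset.prod_insert (by simp [ha]), mul_assoc]

theorem frameDer_X (A : Matrix (Fin (m + n)) (Fin (m + n)) K) (i : Fin (m + n)) (a : Fin m) :
    frameDer K m n A (X (i, a)) = - ∑ k, A i k • (X (k, a) : FrameRing K m n) := by
  simp [frameDer, mkDerivation_X]

theorem frameDer_add (A B : Matrix (Fin (m + n)) (Fin (m + n)) K) :
    frameDer K m n (A + B) = frameDer K m n A + frameDer K m n B := by
  apply derivation_ext
  rintro ⟨i, a⟩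
  simp only [Derivation.add_apply, frameDer_X, Matrix.add_apply, add_smul,
    Finset.sum_add_distrib, neg_add]

theorem frameDer_smul (c : K) (A : Matrix (Fin (m + n)) (Fin (m + n)) K) :
    frameDer K m n (c • A) = c • frameDer K m n A := by
  apply derivation_ext
  rintro ⟨i, a⟩
  simp only [Derivation.smul_apply, frameDer_X, Matrix.smul_apply, smul_neg, Finset.smul_sum,
    smul_eq_mul, mul_smul]

theorem frameDer_lie (A B : Matrix (Fin (m + n)) (Fin (m + n)) K) :
    frameDer K m n ⁅A, B⁆ = ⁅frameDer K m n A, frameDer K m n B⁆ := by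
  have key : ∀ (A B : Matrix (Fin (m + n)) (Fin (m + n)) K) (i : Fin (m + n)) (a : Fin m),
      frameDer K m n A (frameDer K m n B (X (i, a)))
        = ∑ k, (B * A) i k • (X (k, a) : FrameRing K m n) := by
    intro A B i a
    simp only [frameDer_X, map_neg, map_sum, Derivation.map_smul, smul_neg,
      Finset.sum_neg_distrib, neg_neg, Finset.smul_sum, Matrix.mul_apply, Finset.sum_smul,
      mul_smul]
    exact Finset.sum_comm
  apply derivation_ext
  rintro ⟨i, a⟩
  rw [Derivation.commutator_apply, key, key, frameDer_X, Ring.lie_def]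
  simp only [Matrix.sub_apply, sub_smul, Finset.sum_sub_distrib, neg_sub]

theorem plucker_mem (J : Fin m → Fin (m + n)) : plucker K m n J ∈ pluckerSpan K m n :=
  Submodule.subset_span ⟨J, rfl⟩

theorem frameDer_plucker (A : Matrix (Fin (m + n)) (Fin (m + n)) K)
    (J : Fin m → Fin (m + n)) : frameDer K m n A (plucker K m n J) ∈ pluckerSpan K m n := by
  have h : frameDer K m n A (plucker K m n J)
      = ∑ b, - ∑ k, A (J b) k • plucker K m n (Function.update J b k) := by
    have hD : ∀ σ : Equiv.Perm (Fin m),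
        frameDer K m n A (∏ b, (X (J (σ b), b) : FrameRing K m n))
          = ∑ b, - ∑ k, A (J (σ b)) k •
              ∏ c, (X (Function.update J (σ b) k (σ c), c) : FrameRing K m n) := by
      intro σ
      rw [derivation_prod]
      refine Finset.sum_congr rfl fun b _ => ?_
      rw [frameDer_X, mul_neg, Finset.mul_sum]
      congr 1
      refine Finset.sum_congr rfl fun k _ => ?_
      rw [mul_smul_comm]
      congr 1
      rw [← Finset.prod_erase_mul _ _ (Finset.mem_univ b)]
      congr 1
      · refine Finset.prod_congr rfl fun c hc => ?_
        rw [Function.update_of_ne]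
        exact fun h => (Finset.ne_of_mem_erase hc) (σ.injective h)
      · simp
    simp only [plucker, Matrix.det_apply, map_sum, Matrix.of_apply]
    have h1 : ∀ σ : Equiv.Perm (Fin m),
        frameDer K m n A (Equiv.Perm.sign σ • ∏ b, (X (J (σ b), b) : FrameRing K m n))
          = ∑ b, - ∑ k, A (J b) k • (Equiv.Perm.sign σ •
              ∏ c, (X (Function.update J b k (σ c), c) : FrameRing K m n)) := by
      intro σ
      have h2 : frameDer K m n A
          (Equiv.Perm.sign σ • ∏ b, (X (J (σ b), b) : FrameRing K m n))
          = Equiv.Perm.sign σ •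
            frameDer K m n A (∏ b, (X (J (σ b), b) : FrameRing K m n)) := by
        rcases Int.units_eq_one_or (Equiv.Perm.sign σ) with h | h <;> simp [h]
      rw [h2, hD, ← Equiv.sum_comp σ (fun b => - ∑ k, A (J b) k • (Equiv.Perm.sign σ •
              ∏ c, (X (Function.update J b k (σ c), c) : FrameRing K m n)))]
      rcases Int.units_eq_one_or (Equiv.Perm.sign σ) with h | h <;> simp [h]
    simp only [h1]
    rw [Finset.sum_comm]
    refine Finset.sum_congr rfl fun b _ => ?_
    rw [Finset.sum_neg_distrib, Finset.sum_comm]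
    simp only [Finset.smul_sum]
  rw [h]
  refine Submodule.sum_mem _ fun b _ => Submodule.neg_mem _ (Submodule.sum_mem _ fun k _ => ?_)
  exact Submodule.smul_mem _ _ (plucker_mem _)

theorem frameDer_pow_mem (A : Matrix (Fin (m + n)) (Fin (m + n)) K) (k : ℕ)
    {r : FrameRing K m n} (hr : r ∈ pluckerSpan K m n ^ k) :
    frameDer K m n A r ∈ pluckerSpan K m n ^ k := by
  have h1 : ∀ r ∈ pluckerSpan K m n, frameDer K m n A r ∈ pluckerSpan K m n := by
    intro r hr
    induction hr using Submodule.span_induction with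
    | mem x hx => obtain ⟨J, rfl⟩ := hx; exact frameDer_plucker A J
    | zero => simp
    | add x y _ _ hx hy => rw [map_add]; exact Submodule.add_mem _ hx hy
    | smul c x _ hx => rw [Derivation.map_smul]; exact Submodule.smul_mem _ _ hx
  induction k generalizing r with
  | zero =>
    rw [pow_zero, Submodule.mem_one] at hr
    obtain ⟨c, rfl⟩ := hr
    simp
  | succ k ih =>
    rw [pow_succ] at hr ⊢
    induction hr using Submodule.mul_induction_on' with
    | mem_mul_mem a ha b hb =>
      rw [Derivation.leibniz, smul_eq_mul, smul_eq_mul, mul_comm b]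
      exact Submodule.add_mem _ (Submodule.mul_mem_mul ha (h1 b hb))
        (Submodule.mul_mem_mul (ih ha) hb)
    | add x _ y _ hx hy => rw [map_add]; exact Submodule.add_mem _ hx hy

end Action

/-- The global sections `H⁰(X, O_X(d))`, as polynomial functions of a frame.  With `R` the
homogeneous coordinate ring of `X` and `p_J` running over the Plücker coordinates, a section of
`O_X(d) = R(d)~` on `X = Proj R` is an `s` which on every chart `D₊(p_J)` has the form
`r / p_J ^ k` with `r` in `R_{d+k}`.  A priori `s` is a rational function of the frame;
`mem_sections_iff` shows that such an `s` is a polynomial.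
(A zero `p_J` imposes no condition, its chart being empty.) -/
def sections (K : Type*) [Field K] (m n d : ℕ) : Submodule K (FrameRing K m n) where
  carrier := {s | ∀ J : Fin m → Fin (m + n), ∃ k : ℕ,
    s * plucker K m n J ^ k ∈ pluckerSpan K m n ^ (d + k)}
  zero_mem' := fun J => ⟨0, by simp⟩
  add_mem' := by
    intro s t hs ht J
    obtain ⟨k, hk⟩ := hs J
    obtain ⟨j, hj⟩ := ht J
    refine ⟨k + j, ?_⟩
    have e : (s + t) * plucker K m n J ^ (k + j)
        = (s * plucker K m n J ^ k) * plucker K m n J ^ j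
          + (t * plucker K m n J ^ j) * plucker K m n J ^ k := by ring
    rw [e]
    refine Submodule.add_mem _ ?_ ?_
    · rw [← add_assoc, pow_add]
      exact Submodule.mul_mem_mul hk (Submodule.pow_mem_pow _ (plucker_mem J) j)
    · rw [add_comm k j, ← add_assoc, pow_add]
      exact Submodule.mul_mem_mul hj (Submodule.pow_mem_pow _ (plucker_mem J) k)
  smul_mem' := by
    intro c s hs J
    obtain ⟨k, hk⟩ := hs J
    refine ⟨k, ?_⟩
    rw [smul_mul_assoc]
    exact Submodule.smul_mem _ _ hk

section Polynomiality

variable {K : Type*} [Field K] {m n d : ℕ}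

theorem plucker_ne_zero {J : Fin m → Fin (m + n)} (hJ : Function.Injective J) :
    plucker K m n J ≠ 0 := by
  intro h
  have h1 : (eval fun p : Fin (m + n) × Fin m => if p.1 = J p.2 then (1 : K) else 0)
      (plucker K m n J) = 1 := by
    rw [plucker, RingHom.map_det]
    have e : (eval fun p : Fin (m + n) × Fin m => if p.1 = J p.2 then (1 : K) else 0).mapMatrix
        (Matrix.of fun a b : Fin m => (X (J a, b) : FrameRing K m n)) = 1 := by
      ext a b
      simp [Matrix.one_apply, hJ.eq_iff]
    rw [e, Matrix.det_one]
  rw [h, map_zero] at h1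
  exact zero_ne_one h1

theorem degreeOf_plucker {J : Fin m → Fin (m + n)} {i : Fin (m + n)} (hi : ∀ a, J a ≠ i)
    (a : Fin m) : degreeOf (i, a) (plucker K m n J) = 0 := by
  have h : (i, a) ∉ (plucker K m n J).vars := by
    have hm : plucker K m n J ∈ Algebra.adjoin K
        (X '' {p : Fin (m + n) × Fin m | p ≠ (i, a)} : Set (FrameRing K m n)) := by
      rw [plucker, Matrix.det_apply]
      refine Subalgebra.sum_mem _ fun σ _ => ?_
      have hp : ∏ b, (X (J (σ b), b) : FrameRing K m n) ∈ Algebra.adjoin K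
          (X '' {p : Fin (m + n) × Fin m | p ≠ (i, a)} : Set (FrameRing K m n)) :=
        Subalgebra.prod_mem _ fun b _ => Algebra.subset_adjoin
          ⟨_, fun h => hi _ (congrArg Prod.fst h), rfl⟩
      rcases Int.units_eq_one_or (Equiv.Perm.sign σ) with h | h
      · simpa [h] using hp
      · simpa [h] using hp
    have hs := mem_supported.1 (show plucker K m n J ∈ supported K _ from hm)
    intro h
    exact hs h rfl
  classical
  rw [degreeOf_def, Multiset.count_eq_zero]
  simpa [vars_def] using h

/-- The global sections of `O_X(d)`, computed as the rational functions of the frame that have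
the required form on all charts, are the elements of `sections`. -/
theorem mem_sections_iff (f : FractionRing (FrameRing K m n)) :
    (∀ J : Fin m → Fin (m + n), ∃ k : ℕ, ∃ r ∈ pluckerSpan K m n ^ (d + k),
      f * algebraMap _ (FractionRing (FrameRing K m n)) (plucker K m n J) ^ k
        = algebraMap _ (FractionRing (FrameRing K m n)) r) ↔
    ∃ s ∈ sections K m n d, f = algebraMap _ (FractionRing (FrameRing K m n)) s := by
  have hinj := IsFractionRing.injective (FrameRing K m n) (FractionRing (FrameRing K m n))
  constructor
  · intro hf
    suffices hs : ∃ s : FrameRing K m n, f = algebraMap _ (FractionRing (FrameRing K m n)) s by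
      obtain ⟨s, rfl⟩ := hs
      refine ⟨s, fun J => ?_, rfl⟩
      obtain ⟨k, r, hr, h⟩ := hf J
      rw [← map_pow, ← map_mul] at h
      exact ⟨k, (hinj h) ▸ hr⟩
    rcases Nat.eq_zero_or_pos n with hn | hn
    · subst hn
      have hle : pluckerSpan K m 0 ≤ Submodule.span K {plucker K m 0 id} := by
        refine Submodule.span_le.2 ?_
        rintro _ ⟨J, rfl⟩
        by_cases hJ : Function.Injective J
        · have hb : Function.Bijective J := Finite.injective_iff_bijective.1 hJ
          have e : plucker K m 0 J
              = (Equiv.Perm.sign (Equiv.ofBijective J hb) : ℤ) • plucker K m 0 id := by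
            have := Matrix.det_permute (Equiv.ofBijective J hb)
              (Matrix.of fun a b : Fin m => (X (a, b) : FrameRing K m 0))
            rw [zsmul_eq_mul]
            exact this
          rw [e]
          exact zsmul_mem (Submodule.mem_span_singleton_self _) _
        · have e : plucker K m 0 J = 0 := by
            simp only [Function.Injective, not_forall] at hJ
            obtain ⟨a, b, hab, hne⟩ := hJ
            refine Matrix.det_zero_of_row_eq hne ?_
            ext c
            simp [hab]
          rw [e]
          exact Submodule.zero_mem _
      obtain ⟨k, r, hr, h⟩ := hf id
      have hr' : r ∈ Submodule.span K {plucker K m 0 id} ^ (d + k) :=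
        pow_le_pow_left' hle _ hr
      rw [Submodule.span_pow, Set.singleton_pow, Submodule.mem_span_singleton] at hr'
      obtain ⟨c, rfl⟩ := hr'
      refine ⟨c • plucker K m 0 id ^ d, ?_⟩
      have h0 : algebraMap _ (FractionRing (FrameRing K m 0)) (plucker K m 0 id) ^ k ≠ 0 := by
        refine pow_ne_zero _ fun h => plucker_ne_zero (K := K) (m := m) (n := 0)
          (J := id) Function.injective_id (hinj (h.trans (map_zero _).symm))
      refine mul_right_cancel₀ h0 (h.trans ?_)
      rw [← map_pow, ← map_mul, smul_mul_assoc, pow_add]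
    · suffices hu : IsUnit (IsFractionRing.den (FrameRing K m n) f : FrameRing K m n) by
        obtain ⟨s, hs⟩ := IsFractionRing.isInteger_of_isUnit_den hu
        exact ⟨s, hs.symm⟩
      by_contra hu
      obtain ⟨q, hq, hqd⟩ := WfDvdMonoid.exists_irreducible_factor hu
        (nonZeroDivisors.coe_ne_zero _)
      have hp : Prime q := hq.prime
      have hqJ : ∀ J, q ∣ plucker K m n J := by
        intro J
        obtain ⟨k, r, -, h⟩ := hf J
        have h1 : IsFractionRing.num (FrameRing K m n) f * plucker K m n J ^ k
            = r * (IsFractionRing.den (FrameRing K m n) f : FrameRing K m n) := by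
          apply hinj
          have hd : algebraMap _ (FractionRing (FrameRing K m n))
              (IsFractionRing.den (FrameRing K m n) f : FrameRing K m n) ≠ 0 := fun h =>
            nonZeroDivisors.coe_ne_zero _ (hinj (h.trans (map_zero _).symm))
          have h2 := IsFractionRing.mk'_num_den' (FrameRing K m n) f
          rw [div_eq_iff hd] at h2
          rw [map_mul, map_mul, map_pow, ← h, h2]
          ring
        have h3 : q ∣ IsFractionRing.num (FrameRing K m n) f * plucker K m n J ^ k :=
          h1 ▸ hqd.mul_left r
        rcases hp.dvd_or_dvd h3 with h4 | h4
        · exact absurd (IsFractionRing.num_den_reduced (FrameRing K m n) f h4 hqd) hq.not_isUnit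
        · exact hp.dvd_of_dvd_pow h4
      have hdeg : ∀ p, degreeOf p q = 0 := by
        rintro ⟨i, a⟩
        obtain ⟨J, hJ, hi⟩ : ∃ J : Fin m → Fin (m + n),
            Function.Injective J ∧ ∀ a, J a ≠ i := by
          obtain ⟨n, rfl⟩ := Nat.exists_eq_succ_of_ne_zero hn.ne'
          exact ⟨fun a => Fin.succAbove (n := m + n) i (Fin.castAdd n a),
            Fin.succAbove_right_injective.comp (Fin.castAdd_injective m n),
            fun a => Fin.succAbove_ne _ _⟩
        obtain ⟨c, hc⟩ := hqJ J
        have h0 : q * c ≠ 0 := hc ▸ plucker_ne_zero hJ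
        have h1 := degreeOf_plucker (K := K) hi a
        rw [hc, degreeOf_mul_eq (left_ne_zero_of_mul h0) (right_ne_zero_of_mul h0)] at h1
        omega
      have hv : q.vars = ∅ := by
        classical
        rw [Finset.eq_empty_iff_forall_notMem]
        intro p hpv
        have := hdeg p
        rw [degreeOf_def, Multiset.count_eq_zero] at this
        exact this (by simpa [vars_def] using hpv)
      rw [vars_eq_empty_iff_eq_C] at hv
      refine hq.not_isUnit ?_
      rw [hv]
      refine IsUnit.map C (isUnit_iff_ne_zero.2 fun h => hq.ne_zero ?_)
      rw [hv, h, map_zero]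
  · rintro ⟨s, hs, rfl⟩ J
    obtain ⟨k, hk⟩ := hs J
    exact ⟨k, _, hk, by rw [map_mul, map_pow]⟩

end Polynomiality

section ActionOnSections

variable {K : Type*} [Field K] {m n d : ℕ}

theorem frameDer_mem_sections (A : Matrix (Fin (m + n)) (Fin (m + n)) K)
    {s : FrameRing K m n} (hs : s ∈ sections K m n d) :
    frameDer K m n A s ∈ sections K m n d := by
  intro J
  obtain ⟨k, hk⟩ := hs J
  refine ⟨k + 1, ?_⟩
  have e : frameDer K m n A s * plucker K m n J ^ (k + 1)
      = frameDer K m n A (s * plucker K m n J ^ k) * plucker K m n J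
        - k • ((s * plucker K m n J ^ k) * frameDer K m n A (plucker K m n J)) := by
    rw [Derivation.leibniz, Derivation.leibniz_pow]
    simp only [smul_eq_mul, nsmul_eq_mul]
    cases k with
    | zero => simp
    | succ k =>
      simp only [Nat.add_sub_cancel]
      push_cast
      ring
  rw [e, ← add_assoc, pow_succ]
  refine Submodule.sub_mem _ ?_ (nsmul_mem ?_ _)
  · exact Submodule.mul_mem_mul (frameDer_pow_mem A _ hk) (plucker_mem J)
  · exact Submodule.mul_mem_mul hk (frameDer_plucker A J)

end ActionOnSections

/-- The Lie algebra `g = sl(V)` of `G = SL(V)`. -/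
abbrev LieG (K : Type*) [Field K] (m n : ℕ) : LieSubalgebra K
    (Matrix (Fin (m + n)) (Fin (m + n)) K) :=
  LieAlgebra.SpecialLinear.sl (Fin (m + n)) K

instance (K : Type*) [Field K] (m n d : ℕ) :
    LieRingModule (LieG K m n) (sections K m n d) where
  bracket A s := ⟨frameDer K m n A.1 s.1, frameDer_mem_sections A.1 s.2⟩
  add_lie A B s := by
    apply Subtype.ext
    change frameDer K m n (A.1 + B.1) s.1 = frameDer K m n A.1 s.1 + frameDer K m n B.1 s.1
    rw [frameDer_add, Derivation.add_apply]
  lie_add A s t := Subtype.ext (map_add (frameDer K m n A.1) s.1 t.1)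
  leibniz_lie A B s := by
    apply Subtype.ext
    change frameDer K m n A.1 (frameDer K m n B.1 s.1)
      = frameDer K m n ⁅A.1, B.1⁆ s.1 + frameDer K m n B.1 (frameDer K m n A.1 s.1)
    rw [frameDer_lie, Derivation.commutator_apply, sub_add_cancel]

instance (K : Type*) [Field K] (m n d : ℕ) :
    LieModule K (LieG K m n) (sections K m n d) where
  smul_lie c A s := by
    apply Subtype.ext
    change frameDer K m n (c • A.1) s.1 = c • frameDer K m n A.1 s.1
    rw [frameDer_smul, Derivation.smul_apply]
  lie_smul c A s := Subtype.ext (Derivation.map_smul (frameDer K m n A.1) c s.1)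

/-- `V_λ = H⁰(X, O_X(d))*` with the contragredient action `(A φ)(s) = - φ (A s)` of `g`. -/
abbrev VLam (K : Type*) [Field K] (m n d : ℕ) : Type _ := Module.Dual K (sections K m n d)

/-- The Cartan subalgebra `h` of diagonal matrices of trace zero. -/
def cartan (K : Type*) [Field K] (m n : ℕ) : LieSubalgebra K (LieG K m n) where
  carrier := {A | ∀ i j, i ≠ j → A.1 i j = 0}
  zero_mem' := fun _ _ _ => rfl
  add_mem' := by
    intro A B hA hB i j hij
    change A.1 i j + B.1 i j = 0
    rw [hA i j hij, hB i j hij, add_zero]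
  smul_mem' := by
    intro c A hA i j hij
    change c * A.1 i j = 0
    rw [hA i j hij, mul_zero]
  lie_mem' := by
    intro A B hA hB i j hij
    change (A.1 * B.1 - B.1 * A.1) i j = 0
    have key : ∀ A B : LieG K m n, (∀ i j, i ≠ j → A.1 i j = 0) →
        (∀ i j, i ≠ j → B.1 i j = 0) → (A.1 * B.1) i j = 0 := by
      intro A B hA hB
      rw [Matrix.mul_apply]
      refine Finset.sum_eq_zero fun k _ => ?_
      by_cases h : i = k
      · subst h; rw [hB _ _ hij, mul_zero]
      · rw [hA _ _ h, zero_mul]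
    rw [Matrix.sub_apply, key A B hA hB, key B A hB hA, sub_zero]

/-- `v` is a highest weight vector: a nonzero weight vector for the diagonal matrices which is
annihilated by all strictly upper triangular matrices. -/
def IsHighestWeightVector {K : Type*} [Field K] {m n : ℕ} {M : Type*} [AddCommGroup M]
    [Module K M] [LieRingModule (LieG K m n) M] (v : M) : Prop :=
  v ≠ 0 ∧
  (∃ μ : Module.Dual K (cartan K m n), ∀ H : cartan K m n, ⁅(H : LieG K m n), v⁆ = μ H • v) ∧
  ∀ A : LieG K m n, (∀ i j, j ≤ i → A.1 i j = 0) → ⁅A, v⁆ = 0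

/-- The Lie subalgebra `n` of `g` of the block matrices `(0, 0; Y, 0)` with `Y` of size `n × m`,
so that `g = n ⊕ p` with `p = Lie(P)`. -/
def nil (K : Type*) [Field K] (m n : ℕ) : LieSubalgebra K (LieG K m n) where
  carrier := {A | ∀ i j : Fin (m + n), ¬ (m ≤ (i : ℕ) ∧ (j : ℕ) < m) → A.1 i j = 0}
  zero_mem' := fun _ _ _ => rfl
  add_mem' := by
    intro A B hA hB i j hij
    change A.1 i j + B.1 i j = 0
    rw [hA i j hij, hB i j hij, add_zero]
  smul_mem' := by
    intro c A hA i j hij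
    change c * A.1 i j = 0
    rw [hA i j hij, mul_zero]
  lie_mem' := by
    intro A B hA hB i j _
    change (A.1 * B.1 - B.1 * A.1) i j = 0
    have key : ∀ A B : LieG K m n, (∀ i j : Fin (m + n), ¬ (m ≤ (i : ℕ) ∧ (j : ℕ) < m) → A.1 i j = 0) →
        (∀ i j : Fin (m + n), ¬ (m ≤ (i : ℕ) ∧ (j : ℕ) < m) → B.1 i j = 0) → (A.1 * B.1) i j = 0 := by
      intro A B hA hB
      rw [Matrix.mul_apply]
      refine Finset.sum_eq_zero fun k _ => ?_
      by_cases h : (k : ℕ) < m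
      · rw [hB k j (by omega), mul_zero]
      · rw [hA i k (by omega), zero_mul]
    rw [Matrix.sub_apply, key A B hA hB, key B A hB hA, sub_zero]

/-- The canonical filtration `U_l(L)` of the enveloping algebra: the span of all products of at
most `l` elements of the Lie algebra `L`. -/
def envFiltration (K : Type*) [Field K] (L : Type*) [LieRing L] [LieAlgebra K L] (l : ℕ) :
    Submodule K (UniversalEnvelopingAlgebra K L) :=
  ⨆ i : Fin (l + 1),
    LinearMap.range (UniversalEnvelopingAlgebra.ι K : L →ₗ⁅K⁆ _).toLinearMap ^ (i : ℕ)

/-- The action of the enveloping algebra on a module of the Lie algebra. -/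
def envAct (K : Type*) [Field K] (L : Type*) [LieRing L] [LieAlgebra K L] (M : Type*)
    [AddCommGroup M] [Module K M] [LieRingModule L M] [LieModule K L M] :
    UniversalEnvelopingAlgebra K L →ₐ[K] Module.End K M :=
  UniversalEnvelopingAlgebra.lift K (LieModule.toEnd K L M)

/-- The canonical filtration `U_l(L) v = {x(v) : x ∈ U_l(L)}`. -/
def canonicalFiltration (K : Type*) [Field K] (L : Type*) [LieRing L] [LieAlgebra K L]
    {M : Type*} [AddCommGroup M] [Module K M] [LieRingModule L M] [LieModule K L M]
    (v : M) (l : ℕ) : Submodule K M :=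
  (envFiltration K L l).map (LinearMap.applyₗ v ∘ₗ (envAct K L M).toLinearMap)

/-- The ordered monomial `z_1 ^ e_1 ⋯ z_D ^ e_D` in the enveloping algebra. -/
def envMonomial (K : Type*) [Field K] {L : Type*} [LieRing L] [LieAlgebra K L] {D : ℕ}
    (z : Fin D → L) (e : Fin D → ℕ) : UniversalEnvelopingAlgebra K L :=
  (List.ofFn fun i => UniversalEnvelopingAlgebra.ι K (z i) ^ e i).prod

end GrassmannJet

end

/-! A highest weight vector `v` turns out to be a nonzero multiple of evaluation at the base frame
(e_1, …, e_m), which represents the point W. Given this, the rest is calculus on the big cell p_0 ≠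
0. Its affine coordinates are the quotients q / p_0, with q a minor in which one base row is
replaced by a lower row, and 𝔫 acts on them by translations. Hence z^e v is, up to a nonzero scalar,
a constant-coefficient derivative of order |e| at the base point. The sections p_0^(d-|f|) q^f with
|f| ≤ l ≤ d realise all monomials needed to separate these derivatives (`envMonomial_dualMonomial`),
so the z^e v are independent.

Spanning is a PBW-type argument: 𝔤 = 𝔫 + 𝔭, 𝔫 is abelian, and 𝔭 = Lie(P) preserves the line of `v`
because P fixes the base point (`evalBase_frameDer_parabolic`). A factor from 𝔭 can be commuted to
the right without raising the degree (`canonicalFiltration_eq_monomialSpan`). The dimension is then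
a count of exponents.

The identification of `v` avoids irreducibility of V_λ. Sections are homogeneous of degree d under
column operations, and the Casimir operators of the row and column actions differ by a multiple of
the Euler field, so the Casimir of 𝔤𝔩(V) acts by md(d+n) (`casimir_sections`). Evaluating it on a
highest weight vector constrains the row weights k_i. These are integers in [0, d] with sum md, and
the Casimir value leaves only (d, …, d, 0, …, 0) (`weight_eq_zero_of_casimir`). A functional of
weight zero in the lower rows sees only the part of a section not involving those rows. That part is
a multiple of p_0^d (`eq_evalBase_of_lower_weight_zero`). -/

namespace GrassmannJet

open MvPolynomial

/-! ### Derivations of determinants. -/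

section Determinant

/-- A derivation of a determinant, expanded along the columns. -/
theorem derivation_det_updateCol {K R ι : Type*} [Field K] [CommRing R] [Algebra K R]
    [Fintype ι] [DecidableEq ι] (D : Derivation K R R) (M : Matrix ι ι R) :
    D M.det = ∑ b, (M.updateCol b fun i => D (M i b)).det := by
  simp only [Matrix.det_apply, map_sum]
  rw [Finset.sum_comm]
  refine Finset.sum_congr rfl fun σ _ => ?_
  rw [← Finset.smul_sum]
  have h2 : D (Equiv.Perm.sign σ • ∏ b, M (σ b) b)
      = Equiv.Perm.sign σ • D (∏ b, M (σ b) b) := by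
    rcases Int.units_eq_one_or (Equiv.Perm.sign σ) with h | h <;> simp [h]
  rw [h2, derivation_prod]
  congr 1
  refine Finset.sum_congr rfl fun b _ => ?_
  rw [← Finset.prod_erase_mul _ _ (Finset.mem_univ b)]
  congr 1
  · refine Finset.prod_congr rfl fun c hc => ?_
    rw [Matrix.updateCol_ne (Finset.ne_of_mem_erase hc)]
  · simp

/-- A derivation of a determinant, expanded along the rows. -/
theorem derivation_det_updateRow {K R ι : Type*} [Field K] [CommRing R] [Algebra K R]
    [Fintype ι] [DecidableEq ι] (D : Derivation K R R) (M : Matrix ι ι R) :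
    D M.det = ∑ b, (M.updateRow b fun i => D (M b i)).det := by
  rw [← Matrix.det_transpose, derivation_det_updateCol]
  refine Finset.sum_congr rfl fun b _ => ?_
  rw [← Matrix.det_transpose, ← Matrix.updateRow_transpose]
  rfl

end Determinant

/-! ### Row and column polarisation operators and their Casimir identity. -/

section Operators

variable (K : Type*) [Field K] (m n : ℕ)

/-- The derivation `∑ a, X_{ia} ∂_{ja}` of the left action of `gl(V)`. -/
noncomputable def rowDer (i j : Fin (m + n)) :
    Derivation K (FrameRing K m n) (FrameRing K m n) :=
  ∑ a, (X (i, a) : FrameRing K m n) • pderiv (j, a)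

/-- The derivation `∑ i, X_{ia} ∂_{ib}` of the right action of `gl(m)` on frames. -/
noncomputable def colDer (a b : Fin m) :
    Derivation K (FrameRing K m n) (FrameRing K m n) :=
  ∑ i, (X (i, a) : FrameRing K m n) • pderiv (i, b)

variable {K m n}

theorem derivation_sum_apply {ι : Type*} (s : Finset ι)
    (D : ι → Derivation K (FrameRing K m n) (FrameRing K m n)) (f : FrameRing K m n) :
    (∑ i ∈ s, D i) f = ∑ i ∈ s, D i f := by
  classical
  induction s using Finset.induction_on with
  | empty => simp
  | insert a s ha ih => rw [Finset.sum_insert ha, Finset.sum_insert ha, Derivation.add_apply, ih]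

theorem rowDer_apply (i j : Fin (m + n)) (f : FrameRing K m n) :
    rowDer K m n i j f = ∑ a, X (i, a) * pderiv (j, a) f := by
  simp [rowDer, derivation_sum_apply]

theorem colDer_apply (a b : Fin m) (f : FrameRing K m n) :
    colDer K m n a b f = ∑ i, X (i, a) * pderiv (i, b) f := by
  simp [colDer, derivation_sum_apply]

theorem rowDer_X (i j k : Fin (m + n)) (a : Fin m) :
    rowDer K m n i j (X (k, a)) = if j = k then X (i, a) else 0 := by
  rw [rowDer_apply]
  rcases eq_or_ne j k with rfl | h
  · rw [Finset.sum_eq_single a] <;> simp +contextual [pderiv_X]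
  · simp [pderiv_X, h, h.symm]

theorem colDer_X (a b c : Fin m) (k : Fin (m + n)) :
    colDer K m n a b (X (k, c)) = if b = c then X (k, a) else 0 := by
  rw [colDer_apply]
  rcases eq_or_ne b c with rfl | h
  · rw [Finset.sum_eq_single k] <;> simp +contextual [pderiv_X]
  · simp [pderiv_X, h, h.symm]

/-- The indices swap because row j of E_{ji} x is row i of x. The sign comes from the inverse in (g
f)(x) = f(g⁻¹ x). -/
theorem frameDer_single (i j : Fin (m + n)) :
    frameDer K m n (Matrix.single j i 1) = - rowDer K m n i j := by
  apply derivation_ext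
  rintro ⟨k, a⟩
  rw [frameDer_X, Derivation.neg_apply, rowDer_X]
  congr 1
  rcases eq_or_ne j k with rfl | h
  · rw [Finset.sum_eq_single i] <;> simp +contextual [eq_comm]
  · simp [h]

theorem pderiv_pderiv_comm {σ : Type*} (p q : σ) (f : MvPolynomial σ K) :
    pderiv p (pderiv q f) = pderiv q (pderiv p f) := by
  classical
  have h : ⁅pderiv (R := K) p, pderiv q⁆ = (0 : Derivation K (MvPolynomial σ K) _) := by
    apply derivation_ext
    intro i
    rw [Derivation.commutator_apply]
    simp [pderiv_X, Pi.single_apply, apply_ite]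
  have := congrArg (fun D : Derivation K (MvPolynomial σ K) (MvPolynomial σ K) => D f) h
  simpa [Derivation.commutator_apply, sub_eq_zero] using this

theorem sum_mul_sum_add_ite {R ι : Type*} [CommRing R] [Fintype ι] [DecidableEq ι]
    (x y p : ι → R) (q : ι → ι → R) :
    ∑ a, x a * ∑ b, (y b * q a b + if a = b then p a else 0)
      = ∑ a, x a * p a + ∑ a, ∑ b, x a * y b * q a b := by
  rw [← Finset.sum_add_distrib]
  refine Finset.sum_congr rfl fun a _ => ?_
  simp only [Finset.sum_add_distrib, Finset.sum_ite_eq, Finset.mem_univ, if_true, mul_add,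
    Finset.mul_sum, mul_assoc]
  rw [add_comm]

/-- The Casimir operators of the two commuting actions differ by a multiple of the Euler field. -/
theorem casimir_rowDer_colDer (f : FrameRing K m n) :
    ∑ i, ∑ j, rowDer K m n i j (rowDer K m n j i f) + (m : K) • ∑ a, colDer K m n a a f
      = ∑ a, ∑ b, colDer K m n a b (colDer K m n b a f)
        + ((m + n : ℕ) : K) • ∑ a, colDer K m n a a f := by
  have hr : ∀ (i j : Fin (m + n)) (a b : Fin m), pderiv (j, a) (X (j, b) * pderiv (i, b) f)
      = X (j, b) * pderiv (i, b) (pderiv (j, a) f) + if a = b then pderiv (i, a) f else 0 := by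
    intro i j a b
    rw [Derivation.leibniz, pderiv_pderiv_comm, smul_eq_mul, smul_eq_mul]
    rcases eq_or_ne a b with rfl | h
    · simp
    · rw [pderiv_X_of_ne (by simp [h.symm])]
      simp [h]
  have hc : ∀ (i j : Fin (m + n)) (a b : Fin m), pderiv (i, b) (X (j, b) * pderiv (j, a) f)
      = X (j, b) * pderiv (i, b) (pderiv (j, a) f) + if i = j then pderiv (i, a) f else 0 := by
    intro i j a b
    rw [Derivation.leibniz, smul_eq_mul, smul_eq_mul]
    rcases eq_or_ne i j with rfl | h
    · simp
    · rw [pderiv_X_of_ne (by simp [h.symm])]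
      simp [h]
  have h1 : ∀ i j, rowDer K m n i j (rowDer K m n j i f)
      = ∑ a, X (i, a) * pderiv (i, a) f
        + ∑ a, ∑ b, X (i, a) * X (j, b) * pderiv (i, b) (pderiv (j, a) f) := by
    intro i j
    rw [rowDer_apply i j, rowDer_apply j i]
    simp only [map_sum, hr]
    exact sum_mul_sum_add_ite (fun a => X (i, a)) (fun b => X (j, b))
      (fun a => pderiv (i, a) f) (fun a b => pderiv (i, b) (pderiv (j, a) f))
  have h2 : ∀ a b, colDer K m n a b (colDer K m n b a f)
      = ∑ i, X (i, a) * pderiv (i, a) f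
        + ∑ i, ∑ j, X (i, a) * X (j, b) * pderiv (i, b) (pderiv (j, a) f) := by
    intro a b
    rw [colDer_apply a b, colDer_apply b a]
    simp only [map_sum, hc]
    exact sum_mul_sum_add_ite (fun i => X (i, a)) (fun j => X (j, b))
      (fun i => pderiv (i, a) f) (fun i j => pderiv (i, b) (pderiv (j, a) f))
  have h3 : ∑ a, colDer K m n a a f = ∑ i, ∑ a, X (i, a) * pderiv (i, a) f := by
    simp only [colDer_apply]
    exact Finset.sum_comm
  -- With derivatives moved to the right, both Casimirs have the same second-order part. They differ
  -- only in the multiple of the Euler field: m + n for rows, m for columns.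
  have h4 : ∑ i : Fin (m + n), ∑ j, ∑ a, ∑ b,
        X (i, a) * X (j, b) * pderiv (i, b) (pderiv (j, a) f)
      = ∑ a, ∑ b, ∑ i : Fin (m + n), ∑ j,
        X (i, a) * X (j, b) * pderiv (i, b) (pderiv (j, a) f) := by
    rw [Finset.sum_congr rfl fun i _ => Finset.sum_comm, Finset.sum_comm]
    refine Finset.sum_congr rfl fun a _ => ?_
    rw [Finset.sum_congr rfl fun i _ => Finset.sum_comm, Finset.sum_comm]
  have h5 : ∑ i : Fin (m + n), ∑ _j : Fin (m + n), ∑ a, X (i, a) * pderiv (i, a) f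
      = ((m + n : ℕ) : K) • ∑ i, ∑ a, X (i, a) * pderiv (i, a) f := by
    simp only [Finset.sum_const, Finset.card_univ, Fintype.card_fin, Nat.cast_smul_eq_nsmul,
      ← Finset.smul_sum]
  have h6 : ∑ a, ∑ _b : Fin m, ∑ i, X (i, a) * pderiv (i, a) f
      = (m : K) • ∑ i, ∑ a, X (i, a) * pderiv (i, a) f := by
    simp only [Finset.sum_const, Finset.card_univ, Fintype.card_fin, Nat.cast_smul_eq_nsmul,
      ← Finset.smul_sum]
    rw [Finset.sum_comm]
  simp only [h1, h2, Finset.sum_add_distrib, h4]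
  rw [h3, h5, h6]
  abel

end Operators

/-! ### Sections under column operations, and the Casimir eigenvalue. -/

section ColumnAction

variable {K : Type*} [Field K] {m n d : ℕ}

/-- The operator replaces column b of the minor by column a, which creates two equal columns unless
a = b. -/
theorem colDer_plucker (a b : Fin m) (J : Fin m → Fin (m + n)) :
    colDer K m n a b (plucker K m n J) = if a = b then plucker K m n J else 0 := by
  rw [plucker, derivation_det_updateCol, Finset.sum_eq_single b]
  · split_ifs with h
    · subst h
      congr 1
      ext i c
      simp [Matrix.updateCol_apply, colDer_X]
      grind
    · refine Matrix.det_zero_of_column_eq h fun i => ?_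
      simp [colDer_X, h]
  · intro c _ hc
    refine Matrix.det_eq_zero_of_column_eq_zero c fun i => ?_
    simp [colDer_X, hc.symm]
  · simp

theorem colDer_pluckerSpan_pow (a b : Fin m) (k : ℕ) {r : FrameRing K m n}
    (hr : r ∈ pluckerSpan K m n ^ k) :
    colDer K m n a b r = if a = b then (k : K) • r else 0 := by
  have h1 : ∀ r ∈ pluckerSpan K m n, colDer K m n a b r = if a = b then r else 0 := by
    intro r hr
    induction hr using Submodule.span_induction with
    | mem x hx => obtain ⟨J, rfl⟩ := hx; exact colDer_plucker a b J
    | zero => simp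
    | add x y _ _ hx hy => rw [map_add, hx, hy]; split_ifs <;> simp
    | smul c x _ hx => rw [Derivation.map_smul, hx]; split_ifs <;> simp
  induction k generalizing r with
  | zero =>
    rw [pow_zero, Submodule.mem_one] at hr
    obtain ⟨c, rfl⟩ := hr
    simp
  | succ k ih =>
    rw [pow_succ] at hr
    induction hr using Submodule.mul_induction_on' with
    | mem_mul_mem x hx y hy =>
      rw [Derivation.leibniz, smul_eq_mul, smul_eq_mul, ih hx, h1 y hy]
      split_ifs
      · simp only [Nat.cast_succ, Algebra.smul_def, map_add, map_one]; ring
      · simp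
    | add x _ y _ hx hy => rw [map_add, hx, hy]; split_ifs <;> simp

/-- One chart suffices: s p_0^k lies in degree d + k of the Plücker algebra, where the action is
known, and p_0^k cancels by the Leibniz rule in a domain. -/
theorem colDer_sections (a b : Fin m) {s : FrameRing K m n} (hs : s ∈ sections K m n d) :
    colDer K m n a b s = if a = b then (d : K) • s else 0 := by
  obtain ⟨k, hk⟩ := hs (Fin.castAdd n)
  have hp : plucker K m n (Fin.castAdd n) ≠ 0 := plucker_ne_zero (Fin.castAdd_injective m n)
  have h0 := colDer_pluckerSpan_pow a b _ hk
  have hpk := colDer_pluckerSpan_pow a b k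
    (Submodule.pow_mem_pow _ (plucker_mem (K := K) (m := m) (n := n) (Fin.castAdd n)) k)
  rw [Derivation.leibniz, hpk, smul_eq_mul, smul_eq_mul] at h0
  refine mul_left_cancel₀ (pow_ne_zero k hp) ?_
  split_ifs at h0 ⊢
  · simp only [Nat.cast_add, map_add, Algebra.smul_def] at h0 ⊢
    linear_combination h0
  · simpa using h0

/-- The Casimir element of `gl(V)` acts on the sections of `O_X(d)` by `m d (d + n)`. -/
theorem casimir_sections {s : FrameRing K m n} (hs : s ∈ sections K m n d) :
    ∑ i, ∑ j, rowDer K m n i j (rowDer K m n j i s) = ((m * d * (d + n) : ℕ) : K) • s := by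
  have h := casimir_rowDer_colDer s
  have h1 : ∑ a, colDer K m n a a s = (m * d : K) • s := by
    simp [colDer_sections _ _ hs, mul_smul, Nat.cast_smul_eq_nsmul]
  have h2 : ∑ a, ∑ b, colDer K m n a b (colDer K m n b a s) = (m * d * d : K) • s := by
    have : ∀ a b, colDer K m n a b (colDer K m n b a s)
        = if a = b then (d * d : K) • s else 0 := by
      intro a b
      rw [colDer_sections b a hs]
      rcases eq_or_ne a b with rfl | h
      · simp [colDer_sections _ _ hs, mul_smul]
      · simp [h, h.symm]
    simp [this, mul_smul, Nat.cast_smul_eq_nsmul]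
  rw [h1, h2] at h
  rw [eq_sub_of_add_eq h, smul_smul, smul_smul, ← add_smul, ← sub_smul]
  congr 1
  push_cast
  ring

/-- Scalar matrices act through the degree. -/
theorem sum_rowDer_sections {s : FrameRing K m n} (hs : s ∈ sections K m n d) :
    ∑ i, rowDer K m n i i s = (m * d : K) • s := by
  have h1 : ∑ a, colDer K m n a a s = (m * d : K) • s := by
    simp [colDer_sections _ _ hs, mul_smul, Nat.cast_smul_eq_nsmul]
  rw [← h1]
  simp only [colDer_apply, rowDer_apply]
  exact Finset.sum_comm

theorem rowDer_mem_sections (i j : Fin (m + n)) {s : FrameRing K m n}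
    (hs : s ∈ sections K m n d) : rowDer K m n i j s ∈ sections K m n d := by
  have := frameDer_mem_sections (Matrix.single j i 1) hs
  rw [frameDer_single, Derivation.neg_apply] at this
  simpa using Submodule.neg_mem _ this

/-- The relation [E_ij, E_ji] = E_ii - E_jj, used to move raising operators to the outside, where a
highest weight functional kills them. -/
theorem rowDer_comm (i j : Fin (m + n)) (f : FrameRing K m n) :
    rowDer K m n i j (rowDer K m n j i f)
      = rowDer K m n j i (rowDer K m n i j f) + rowDer K m n i i f - rowDer K m n j j f := by
  have h : ⁅rowDer K m n i j, rowDer K m n j i⁆ = rowDer K m n i i - rowDer K m n j j := by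
    apply derivation_ext
    rintro ⟨k, a⟩
    rw [Derivation.commutator_apply, Derivation.sub_apply]
    simp only [rowDer_X, apply_ite (rowDer K m n i j), apply_ite (rowDer K m n j i), map_zero]
    simp
  have := congrArg (fun D : Derivation K (FrameRing K m n) (FrameRing K m n) => D f) h
  simp only [Derivation.commutator_apply, Derivation.sub_apply] at this
  linear_combination this

end ColumnAction

end GrassmannJet

namespace GrassmannJet

open MvPolynomial

/-! ### The Casimir value determines the weight. -/

section Arithmetic

/-- Among the weights with entries in `[0, d]` and sum `m d`, only `(d, …, d, 0, …, 0)` has the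
Casimir value `m d (d + n)`. -/
theorem weight_eq_zero_of_casimir {m n d : ℕ} (k : Fin (m + n) → ℤ) (h0 : ∀ i, 0 ≤ k i)
    (hd : ∀ i, k i ≤ d) (hs : ∑ i, k i = m * d)
    (hc : ∑ i, ∑ j, (if i = j then k i * k i else if i < j then k i - k j else 0)
      = m * d * (d + n)) (i : Fin (m + n)) (hi : m ≤ (i : ℕ)) : k i = 0 := by
  -- Since the quadratic part is at most m d², the linear part of the Casimir value must be at least
  -- m d n, its value at the extremal weight `c` below.
  have hsq : ∑ i, k i * k i ≤ d * (m * d) := by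
    rw [← hs, Finset.mul_sum]
    exact Finset.sum_le_sum fun i _ => mul_le_mul_of_nonneg_right (hd i) (h0 i)
  have hsplit : ∑ i, ∑ j, (if i = j then k i * k i else if i < j then k i - k j else 0)
      = ∑ i, k i * k i + ∑ i : Fin (m + n), ((m + n : ℤ) - 1 - 2 * (i : ℕ)) * k i := by
    have e : ∀ i j, (if i = j then k i * k i else if i < j then k i - k j else 0)
        = (if i = j then k i * k i else 0) + ((if i < j then k i else 0)
          - (if i < j then k j else 0)) := by
      intro i j
      rcases lt_trichotomy i j with h | h | h
      · simp [h, h.ne]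
      · simp [h]
      · simp [h.ne', h.not_gt]
    simp only [e, Finset.sum_add_distrib, Finset.sum_sub_distrib]
    rw [Finset.sum_comm (f := fun i j => if i < j then k j else 0)]
    have h1 : ∀ i : Fin (m + n), ∑ j, (if i < j then k i else 0) = (m + n - 1 - (i : ℕ)) * k i := by
      intro i
      rw [← Finset.sum_filter, Finset.sum_const, Finset.filter_lt_eq_Ioi, Fin.card_Ioi, nsmul_eq_mul]
      congr 1
      have := i.2
      omega
    have h2 : ∀ j : Fin (m + n), ∑ i, (if i < j then k j else 0) = (j : ℕ) * k j := by
      intro i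
      rw [← Finset.sum_filter, Finset.sum_const, Finset.filter_gt_eq_Iio, Fin.card_Iio, nsmul_eq_mul]
    simp only [h1, h2, Finset.sum_ite_eq, Finset.mem_univ, if_true]
    rw [← Finset.sum_sub_distrib]
    congr 1
    exact Finset.sum_congr rfl fun i _ => by ring
  let c : Fin (m + n) → ℤ := fun i => if (i : ℕ) < m then d else 0
  have hcs : ∑ i, c i = m * d := by simp [c, Fin.sum_univ_add]
  have hcw : ∑ i : Fin (m + n), ((m + n : ℤ) - 1 - 2 * (i : ℕ)) * c i = m * d * n := by
    have hg : ∀ m : ℕ, 2 * ∑ i : Fin m, ((i : ℕ) : ℤ) = m * (m - 1) := by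
      intro m
      induction m with
      | zero => simp
      | succ m ih => rw [Fin.sum_univ_castSucc, mul_add]; simp [ih]; ring
    simp only [Fin.sum_univ_add, c, Fin.val_castAdd, Fin.is_lt, if_true, Fin.val_natAdd,
      Nat.not_lt.2 (Nat.le_add_right m _), if_false, mul_zero, Finset.sum_const_zero, add_zero]
    rw [← Finset.sum_mul, Finset.sum_sub_distrib, ← Finset.mul_sum, hg]
    simp
    ring
  -- The added term (n - m)(k - c) sums to zero and recentres the coefficients to 2m - 1 - 2j. These
  -- are odd and change sign exactly between the first m rows and the others, so each summand is
  -- nonnegative, and at least `k j` in a lower row.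
  have hpos : ∀ j : Fin (m + n), (if m ≤ (j : ℕ) then k j else 0)
      ≤ ((n : ℤ) - m) * (k j - c j) + ((m + n : ℤ) - 1 - 2 * (j : ℕ)) * (c j - k j) := by
    intro j
    have e : ((n : ℤ) - m) * (k j - c j) + ((m + n : ℤ) - 1 - 2 * (j : ℕ)) * (c j - k j)
        = (2 * m - 1 - 2 * (j : ℕ)) * (c j - k j) := by ring
    rw [e]
    by_cases hj : m ≤ (j : ℕ)
    · simp only [c, hj, if_true, Nat.not_lt.2 hj, if_false]
      have := h0 j
      have : (m : ℤ) ≤ (j : ℕ) := by exact_mod_cast hj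
      nlinarith
    · simp only [c, hj, if_false, Nat.not_le.1 hj, if_true]
      have := hd j
      have : ((j : ℕ) : ℤ) + 1 ≤ m := by exact_mod_cast Nat.not_le.1 hj
      exact mul_nonneg (by linarith) (by linarith)
  have hsum := Finset.sum_le_sum fun j (_ : j ∈ Finset.univ) => hpos j
  rw [Finset.sum_add_distrib, ← Finset.mul_sum, Finset.sum_sub_distrib, hs, hcs] at hsum
  simp only [mul_sub _ (c _), Finset.sum_sub_distrib] at hsum
  rw [hcw] at hsum
  have hle : ∑ j : Fin (m + n), (if m ≤ (j : ℕ) then k j else 0) ≤ 0 := by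
    rw [hsplit] at hc
    nlinarith
  have h1 := Finset.single_le_sum (f := fun j : Fin (m + n) => if m ≤ (j : ℕ) then k j else 0)
    (fun j _ => by split_ifs <;> simp [h0]) (Finset.mem_univ i)
  simp only [hi, if_true] at h1
  exact le_antisymm (h1.trans hle) (h0 i)

end Arithmetic

/-! ### Grading by degree in a set of rows, and integrality of weights. -/

section RowGrading

variable {K : Type*} [Field K] {m n d : ℕ}

variable (K) in
/-- Scaling the rows in `A` by an indeterminate. -/
noncomputable def rowScale (A : Finset (Fin (m + n))) :
    FrameRing K m n →ₐ[K] Polynomial (FrameRing K m n) :=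
  aeval fun p => (if p.1 ∈ A then Polynomial.X else 1) * Polynomial.C (X p)

theorem rowScale_plucker (A : Finset (Fin (m + n))) (J : Fin m → Fin (m + n)) :
    rowScale K A (plucker K m n J)
      = (∏ c, if J c ∈ A then Polynomial.X else 1) * Polynomial.C (plucker K m n J) := by
  have h := Matrix.det_mul_column
    (fun c => if J c ∈ A then (Polynomial.X : Polynomial (FrameRing K m n)) else 1)
    (Matrix.of fun a b : Fin m => Polynomial.C (X (J a, b) : FrameRing K m n))
  rw [plucker, AlgHom.map_det, RingHom.map_det]
  convert h using 2
  · ext1 a b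
    simp [rowScale]
  · rfl

theorem eval_one_rowScale (A : Finset (Fin (m + n))) (f : FrameRing K m n) :
    (rowScale K A f).eval 1 = f := by
  induction f using MvPolynomial.induction_on with
  | C a => simp [rowScale, algebraMap_eq]
  | add p q hp hq => simp [hp, hq]
  | mul_X p q hp =>
    rw [map_mul, Polynomial.eval_mul, hp]
    simp [rowScale, apply_ite (Polynomial.eval (1 : FrameRing K m n))]

theorem rowScale_injective (A : Finset (Fin (m + n))) :
    Function.Injective (rowScale K (m := m) (n := n) A) := fun f g h => by
  rw [← eval_one_rowScale A f, h, eval_one_rowScale]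

/-- Euler's identity for the rows in `A`: the diagonal operators become t d/dt in the scaling
variable t, so the coefficient of t^j has eigenvalue j. -/
theorem rowScale_sum_rowDer (A : Finset (Fin (m + n))) (f : FrameRing K m n) :
    rowScale K A (∑ i ∈ A, rowDer K m n i i f)
      = Polynomial.X * Polynomial.derivative (rowScale K A f) := by
  have hX : ∀ p, rowScale K A (∑ i ∈ A, rowDer K m n i i (X p))
      = Polynomial.X * Polynomial.derivative (rowScale K A (X p)) := by
    rintro ⟨k, a⟩
    simp only [rowDer_X, Finset.sum_ite_eq']
    split_ifs with h <;> simp [rowScale, h]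
  induction f using MvPolynomial.induction_on with
  | C a => simp [rowScale, ← algebraMap_eq]
  | add p q hp hq => simp only [map_add, Finset.sum_add_distrib, hp, hq, mul_add]
  | mul_X p q hp =>
    have e : ∑ i ∈ A, rowDer K m n i i (p * X q)
        = p * ∑ i ∈ A, rowDer K m n i i (X q) + X q * ∑ i ∈ A, rowDer K m n i i p := by
      simp only [Derivation.leibniz, Finset.sum_add_distrib, smul_eq_mul, Finset.mul_sum]
    rw [e, map_add, map_mul, map_mul, hp, hX, map_mul, Polynomial.derivative_mul]
    ring

/-- The operator `∑ a, X_{ia} ∂_{ja}` on the sections. -/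
noncomputable def rowEnd (K : Type*) [Field K] (m n d : ℕ) (i j : Fin (m + n)) :
    Module.End K (sections K m n d) :=
  (rowDer K m n i j : FrameRing K m n →ₗ[K] FrameRing K m n).restrict
    fun _ hs => rowDer_mem_sections i j hs

theorem rowEnd_coe (i j : Fin (m + n)) (s : sections K m n d) :
    (rowEnd K m n d i j s : FrameRing K m n) = rowDer K m n i j s := rfl

/-- Polynomials in the Euler operator select graded components while staying inside the sections, so
it need not be known that the components are themselves sections. -/
theorem coeff_rowScale_aeval (A : Finset (Fin (m + n))) (q : Polynomial K)
    (s : sections K m n d) (j : ℕ) :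
    (rowScale K A (Polynomial.aeval (∑ i ∈ A, rowEnd K m n d i i) q s :
      sections K m n d)).coeff j = q.eval (j : K) • (rowScale K A s).coeff j := by
  induction q using Polynomial.induction_on generalizing s with
  | C a => simp [Module.algebraMap_end_apply]
  | add p q hp hq => simp [hp, hq, add_smul]
  | monomial k a ih =>
    rw [pow_succ, ← mul_assoc, map_mul, Module.End.mul_apply, ih, Polynomial.aeval_X,
      Polynomial.eval_mul (q := Polynomial.X), mul_smul, Polynomial.eval_X]
    congr 1
    have e : (((∑ i ∈ A, rowEnd K m n d i i) s : sections K m n d) : FrameRing K m n)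
        = ∑ i ∈ A, rowDer K m n i i s := by
      simp [LinearMap.sum_apply, rowEnd_coe]
    rw [e, rowScale_sum_rowDer]
    rcases j with _ | j
    · simp
    · rw [Polynomial.coeff_X_mul, Polynomial.coeff_derivative]
      simp only [Algebra.smul_def, map_natCast, Nat.cast_succ, map_add, map_one]
      ring

theorem map_aeval_of_eigen {V : Type*} [AddCommGroup V] [Module K V] (T : Module.End K V)
    (φ : Module.Dual K V) (c : K) (h : ∀ s, φ (T s) = c * φ s) (q : Polynomial K) (s : V) :
    φ (Polynomial.aeval T q s) = q.eval c * φ s := by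
  induction q using Polynomial.induction_on generalizing s with
  | C a => simp [Module.algebraMap_end_apply]
  | add p q hp hq => simp [hp, hq, add_mul]
  | monomial k a ih =>
    rw [pow_succ, ← mul_assoc, map_mul, Module.End.mul_apply, ih, Polynomial.aeval_X, h,
      Polynomial.eval_mul (q := Polynomial.X), Polynomial.eval_X, mul_assoc]

theorem plucker_eq_zero {J : Fin m → Fin (m + n)} (hJ : ¬ Function.Injective J) :
    plucker K m n J = 0 := by
  simp only [Function.Injective, not_forall] at hJ
  obtain ⟨a, b, hab, hne⟩ := hJ
  refine Matrix.det_zero_of_row_eq hne ?_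
  ext c
  simp [hab]

/-- A nonzero minor uses row i at most once, so it is at most linear in that row. -/
theorem natDegree_rowScale_pluckerSpan_pow (i : Fin (m + n)) (k : ℕ) {r : FrameRing K m n}
    (hr : r ∈ pluckerSpan K m n ^ k) : (rowScale K {i} r).natDegree ≤ k := by
  have h1 : ∀ r ∈ pluckerSpan K m n, (rowScale K {i} r).natDegree ≤ 1 := by
    intro r hr
    induction hr using Submodule.span_induction with
    | mem x hx =>
      obtain ⟨J, rfl⟩ := hx
      by_cases hJ : Function.Injective J
      · rw [rowScale_plucker]
        refine (Polynomial.natDegree_mul_C_le _ _).trans ?_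
        refine (Polynomial.natDegree_prod_le _ _).trans ?_
        have e : ∀ c, (if J c ∈ ({i} : Finset _) then
            (Polynomial.X : Polynomial (FrameRing K m n)) else 1).natDegree
              = if J c = i then 1 else 0 := by
          intro c
          split_ifs with h1 h2 h2 <;> simp_all
        simp only [e, Finset.sum_boole, Nat.cast_id]
        refine Finset.card_le_one.2 fun a ha b hb => hJ ?_
        simp only [Finset.mem_filter] at ha hb
        rw [ha.2, hb.2]
      · simp [plucker_eq_zero hJ]
    | zero => simp
    | add x y _ _ hx hy =>
      rw [map_add]; exact (Polynomial.natDegree_add_le _ _).trans (max_le hx hy)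
    | smul c x _ hx => rw [map_smul]; exact (Polynomial.natDegree_smul_le _ _).trans hx
  induction k generalizing r with
  | zero =>
    rw [pow_zero, Submodule.mem_one] at hr
    obtain ⟨c, rfl⟩ := hr
    rw [AlgHom.commutes, Polynomial.algebraMap_apply]
    simp
  | succ k ih =>
    rw [pow_succ] at hr
    induction hr using Submodule.mul_induction_on' with
    | mem_mul_mem a ha b hb =>
      rw [map_mul]
      exact Polynomial.natDegree_mul_le.trans (add_le_add (ih ha) (h1 b hb))
    | add x _ y _ hx hy =>
      rw [map_add]; exact (Polynomial.natDegree_add_le _ _).trans (max_le hx hy)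

/-- Sections of `O_X(d)` have degree at most `d` in every row. -/
theorem natDegree_rowScale_sections (i : Fin (m + n)) {s : FrameRing K m n}
    (hs : s ∈ sections K m n d) : (rowScale K {i} s).natDegree ≤ d := by
  rcases Nat.eq_zero_or_pos m with rfl | hm
  · obtain ⟨c, rfl⟩ := C_surjective (R := K) (Fin (0 + n) × Fin 0) s
    rw [← algebraMap_eq, AlgHom.commutes, Polynomial.algebraMap_apply]
    simp
  -- A chart whose minor does contain row i is chosen: then p_J has degree exactly 1 in that row,
  -- and deg s + k ≤ d + k gives the bound.
  · obtain ⟨J, hJ, a, ha⟩ : ∃ J : Fin m → Fin (m + n), Function.Injective J ∧ ∃ a, J a = i := by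
      refine ⟨Equiv.swap (Fin.castAdd n ⟨0, hm⟩) i ∘ Fin.castAdd n,
        (Equiv.injective _).comp (Fin.castAdd_injective m n), ⟨0, hm⟩, by simp⟩
    obtain ⟨k, hk⟩ := hs J
    rcases eq_or_ne s 0 with rfl | hs0
    · simp
    have h := natDegree_rowScale_pluckerSpan_pow i _ hk
    have hp : rowScale K {i} (plucker K m n J) = Polynomial.X * Polynomial.C (plucker K m n J) := by
      rw [rowScale_plucker, Finset.prod_eq_single a]
      · simp [ha]
      · intro b _ hb
        rw [if_neg]
        simp only [Finset.mem_singleton, ← ha]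
        exact fun h => hb (hJ h)
      · simp
    have hpd : (rowScale K {i} (plucker K m n J)).natDegree = 1 := by
      rw [hp, mul_comm, Polynomial.natDegree_C_mul_X _ (plucker_ne_zero hJ)]
    have h0 : rowScale K {i} (plucker K m n J) ≠ 0 := fun h => by simp [h] at hpd
    have h1 : rowScale K {i} s ≠ 0 := fun h => hs0 (rowScale_injective _ (h.trans (map_zero _).symm))
    rw [map_mul, map_pow, Polynomial.natDegree_mul h1 (pow_ne_zero _ h0), Polynomial.natDegree_pow,
      hpd] at h
    omega

/-- The row degrees of sections lie in {0, …, d}, so the product of the E_ii - j over these j kills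
every section. Applying φ makes μ a root of that product. -/
theorem weight_nat (i : Fin (m + n)) (φ : VLam K m n d) (hφ : φ ≠ 0) (μ : K)
    (h : ∀ s, φ (rowEnd K m n d i i s) = μ * φ s) : ∃ k : ℕ, k ≤ d ∧ μ = k := by
  obtain ⟨s, hs⟩ : ∃ s, φ s ≠ 0 := by
    by_contra! h0
    exact hφ (LinearMap.ext h0)
  let q : Polynomial K := ∏ j ∈ Finset.range (d + 1), (Polynomial.X - Polynomial.C (j : K))
  have hq : Polynomial.aeval (∑ j ∈ ({i} : Finset _), rowEnd K m n d j j) q s = 0 := by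
    apply Subtype.ext
    apply rowScale_injective {i}
    ext1 j
    rw [coeff_rowScale_aeval]
    rcases Nat.lt_or_ge d j with hj | hj
    · rw [Polynomial.coeff_eq_zero_of_natDegree_lt
        ((natDegree_rowScale_sections i s.2).trans_lt hj)]
      simp
    · have : q.eval (j : K) = 0 := by
        rw [Polynomial.eval_prod]
        exact Finset.prod_eq_zero (Finset.mem_range.2 (Nat.lt_succ_of_le hj)) (by simp)
      simp [this]
  have h2 := map_aeval_of_eigen (∑ j ∈ ({i} : Finset _), rowEnd K m n d j j) φ μ (by simpa using h) q s
  rw [hq, map_zero, eq_comm, mul_eq_zero, or_iff_left hs, Polynomial.eval_prod,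
    Finset.prod_eq_zero_iff] at h2
  obtain ⟨k, hk, hk'⟩ := h2
  exact ⟨k, Nat.lt_succ_iff.1 (Finset.mem_range.1 hk), by simpa [sub_eq_zero] using hk'⟩

end RowGrading

/-! ### Highest weight functionals are evaluations at the base frame. -/

section BaseFrame

variable {K : Type*} [Field K] {m n d : ℕ}

variable (K m n) in
/-- Evaluation at the frame `(e_1, …, e_m)`. -/
noncomputable def evalBase : FrameRing K m n →ₐ[K] K :=
  aeval fun p => if p.1 = Fin.castAdd n p.2 then 1 else 0

variable (K m n) in
/-- The Plücker coordinate of the first `m` rows. -/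
noncomputable def basePlucker : FrameRing K m n := plucker K m n (Fin.castAdd n)

theorem evalBase_basePlucker : evalBase K m n (basePlucker K m n) = 1 := by
  rw [basePlucker, plucker, AlgHom.map_det]
  convert Matrix.det_one (R := K) (n := Fin m)
  ext a b
  simp [evalBase, Matrix.one_apply]

theorem basePlucker_ne_zero : basePlucker K m n ≠ 0 :=
  plucker_ne_zero (Fin.castAdd_injective m n)

theorem pluckerSpan_pow_le_sections : pluckerSpan K m n ^ d ≤ sections K m n d := fun s hs J =>
  ⟨0, by simpa using hs⟩

variable (n) in
/-- The rows below the first `m`. -/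
def lowerRows (m : ℕ) : Finset (Fin (m + n)) := Finset.univ.filter fun i => m ≤ (i : ℕ)

/-- Setting the lower rows to zero kills each minor that uses one of them. A nonzero minor in the
first m rows alone is p_0 up to the sign of a permutation. -/
theorem coeff_zero_rowScale_pluckerSpan {r : FrameRing K m n} {k : ℕ}
    (hr : r ∈ pluckerSpan K m n ^ k) :
    ∃ c : K, (rowScale K (lowerRows n m) r).coeff 0 = c • basePlucker K m n ^ k := by
  have h1 : ∀ r ∈ pluckerSpan K m n,
      ∃ c : K, (rowScale K (lowerRows n m) r).coeff 0 = c • basePlucker K m n := by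
    intro r hr
    induction hr using Submodule.span_induction with
    | mem x hx =>
      obtain ⟨J, rfl⟩ := hx
      by_cases hJ : Function.Injective J
      · rw [rowScale_plucker, Polynomial.mul_coeff_zero, Polynomial.coeff_C_zero,
          Polynomial.coeff_zero_prod]
        by_cases hl : ∀ c, (J c : ℕ) < m
        · let σ : Fin m → Fin m := fun c => ⟨J c, hl c⟩
          have hσ : Function.Bijective σ := Finite.injective_iff_bijective.1 fun a b h =>
            hJ (Fin.ext (by simpa [σ] using h))
          have e : plucker K m n J
              = (Equiv.Perm.sign (Equiv.ofBijective σ hσ) : ℤ) • basePlucker K m n := by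
            have := Matrix.det_permute (Equiv.ofBijective σ hσ)
              (Matrix.of fun a b : Fin m => (X (Fin.castAdd n a, b) : FrameRing K m n))
            rw [zsmul_eq_mul]
            exact this
          refine ⟨((Equiv.Perm.sign (Equiv.ofBijective σ hσ) : ℤ) : K), ?_⟩
          rw [Int.cast_smul_eq_zsmul, ← e, Finset.prod_eq_one, one_mul]
          intro c _
          rw [if_neg (by simp [lowerRows, hl c]), Polynomial.coeff_one_zero]
        · push Not at hl
          obtain ⟨c, hc⟩ := hl
          refine ⟨0, ?_⟩
          rw [Finset.prod_eq_zero (Finset.mem_univ c), zero_mul, zero_smul]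
          rw [if_pos (by simp [lowerRows, hc]), Polynomial.coeff_X_zero]
      · exact ⟨0, by simp [plucker_eq_zero hJ]⟩
    | zero => exact ⟨0, by simp⟩
    | add x y _ _ hx hy =>
      obtain ⟨a, ha⟩ := hx
      obtain ⟨b, hb⟩ := hy
      exact ⟨a + b, by rw [map_add, Polynomial.coeff_add, ha, hb, add_smul]⟩
    | smul c x _ hx =>
      obtain ⟨a, ha⟩ := hx
      exact ⟨c * a, by rw [map_smul, Polynomial.coeff_smul, ha, mul_smul]⟩
  induction k generalizing r with
  | zero =>
    rw [pow_zero, Submodule.mem_one] at hr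
    obtain ⟨c, rfl⟩ := hr
    exact ⟨c, by rw [AlgHom.commutes, Polynomial.algebraMap_apply]; simp [Algebra.smul_def]⟩
  | succ k ih =>
    rw [pow_succ] at hr
    induction hr using Submodule.mul_induction_on' with
    | mem_mul_mem x hx y hy =>
      obtain ⟨a, ha⟩ := ih hx
      obtain ⟨b, hb⟩ := h1 y hy
      exact ⟨a * b, by rw [map_mul, Polynomial.mul_coeff_zero, ha, hb, smul_mul_smul_comm, pow_succ]⟩
    | add x _ y _ hx hy =>
      obtain ⟨a, ha⟩ := hx
      obtain ⟨b, hb⟩ := hy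
      exact ⟨a + b, by rw [map_add, Polynomial.coeff_add, ha, hb, add_smul]⟩

/-- The lower rows of the base frame vanish already, so setting them to zero does not change the
value there. -/
theorem evalBase_coeff_zero_rowScale (s : FrameRing K m n) :
    evalBase K m n ((rowScale K (lowerRows n m) s).coeff 0) = evalBase K m n s := by
  induction s using MvPolynomial.induction_on with
  | C a => simp [rowScale, ← algebraMap_eq]
  | add p q hp hq => simp [hp, hq]
  | mul_X p q hp =>
    rw [map_mul, Polynomial.mul_coeff_zero, map_mul, hp, map_mul]
    congr 1
    by_cases h : m ≤ (q.1 : ℕ)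
    · have : q.1 ≠ Fin.castAdd n q.2 := fun h' => by
        have := congrArg Fin.val h'
        simp only [Fin.val_castAdd] at this
        omega
      simp [rowScale, lowerRows, h, evalBase, this]
    · simp [rowScale, lowerRows, h]

theorem coeff_zero_rowScale_sections {s : FrameRing K m n} (hs : s ∈ sections K m n d) :
    (rowScale K (lowerRows n m) s).coeff 0 = evalBase K m n s • basePlucker K m n ^ d := by
  obtain ⟨k, hk⟩ := hs (Fin.castAdd n)
  obtain ⟨c, hc⟩ := coeff_zero_rowScale_pluckerSpan hk
  have hp : (rowScale K (lowerRows n m) (plucker K m n (Fin.castAdd n))).coeff 0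
      = basePlucker K m n := by
    rw [rowScale_plucker, Finset.prod_eq_one, one_mul, Polynomial.coeff_C_zero, basePlucker]
    intro c _
    rw [if_neg (by simp [lowerRows])]
  have e : (rowScale K (lowerRows n m) s).coeff 0 = c • basePlucker K m n ^ d := by
    rw [map_mul, map_pow, Polynomial.mul_coeff_zero, Polynomial.coeff_zero_eq_eval_zero (_ ^ k),
      Polynomial.eval_pow, ← Polynomial.coeff_zero_eq_eval_zero, hp, pow_add,
      ← smul_mul_assoc] at hc
    exact mul_right_cancel₀ (pow_ne_zero k basePlucker_ne_zero) hc
  have h2 := congrArg (evalBase K m n) e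
  rw [evalBase_coeff_zero_rowScale, map_smul, map_pow, evalBase_basePlucker] at h2
  rw [e, h2]
  simp

variable (K m n d) in
/-- The section `p_0 ^ d`. -/
noncomputable def baseSection : sections K m n d :=
  ⟨basePlucker K m n ^ d, pluckerSpan_pow_le_sections (Submodule.pow_mem_pow _ (plucker_mem _) d)⟩

/-- A functional on the sections of weight zero in the lower rows is a multiple of the evaluation
at the base frame. -/
theorem eq_evalBase_of_lower_weight_zero [CharZero K] (φ : VLam K m n d)
    (h : ∀ i : Fin (m + n), m ≤ (i : ℕ) → ∀ s, φ (rowEnd K m n d i i s) = 0)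
    (s : sections K m n d) : φ s = φ (baseSection K m n d) * evalBase K m n s := by
  set T := ∑ i ∈ lowerRows n m, rowEnd K m n d i i with hT
  have hφT : ∀ s, φ (T s) = 0 * φ s := by
    intro s
    rw [hT, LinearMap.sum_apply, map_sum, zero_mul]
    exact Finset.sum_eq_zero fun i hi => h i (by simpa [lowerRows] using hi) s
  let B := (rowScale K (lowerRows n m) (s : FrameRing K m n)).natDegree
  -- The roots 1, …, B remove all components of positive lower degree, while q(0) ≠ 0 in
  -- characteristic zero. Thus q(T) s is q(0) times the degree-zero part of s, and φ(q(T) s) = q(0)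
  -- φ(s).
  let q : Polynomial K := ∏ j ∈ Finset.Icc 1 B, (Polynomial.X - Polynomial.C (j : K))
  have hq0 : q.eval 0 ≠ 0 := by
    rw [Polynomial.eval_prod, Finset.prod_ne_zero_iff]
    intro j hj
    have : j ≠ 0 := by have := Finset.mem_Icc.1 hj; omega
    simpa using this
  have hq : (Polynomial.aeval T q s : sections K m n d)
      = (q.eval 0 * evalBase K m n s) • baseSection K m n d := by
    apply Subtype.ext
    apply rowScale_injective (lowerRows n m)
    have hb : (rowScale K (lowerRows n m) (basePlucker K m n ^ d))
        = Polynomial.C (basePlucker K m n ^ d) := by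
      rw [map_pow, map_pow, basePlucker, rowScale_plucker, Finset.prod_eq_one, one_mul]
      intro c _
      rw [if_neg (by simp [lowerRows])]
    ext1 j
    rw [coeff_rowScale_aeval, Submodule.coe_smul, map_smul, Polynomial.coeff_smul]
    change _ = _ • (rowScale K (lowerRows n m) (basePlucker K m n ^ d)).coeff j
    rw [hb]
    rcases Nat.eq_zero_or_pos j with rfl | hj
    · rw [coeff_zero_rowScale_sections s.2, Polynomial.coeff_C_zero, mul_smul, Nat.cast_zero]
    · rw [Polynomial.coeff_C_of_ne_zero hj.ne', smul_zero]
      rcases Nat.lt_or_ge B j with hB | hB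
      · rw [Polynomial.coeff_eq_zero_of_natDegree_lt hB, smul_zero]
      · have : q.eval (j : K) = 0 := by
          rw [Polynomial.eval_prod]
          exact Finset.prod_eq_zero (Finset.mem_Icc.2 ⟨hj, hB⟩) (by simp)
        rw [this, zero_smul]
  have h2 := map_aeval_of_eigen T φ 0 hφT q s
  rw [hq, map_smul, smul_eq_mul, mul_assoc] at h2
  rw [← mul_left_cancel₀ hq0 h2, mul_comm]

/-- A weight functional on the sections that is killed by the raising operators is a multiple of
the evaluation at the base frame. -/
theorem eq_evalBase_of_highest_weight [CharZero K] (φ : VLam K m n d) (hφ : φ ≠ 0)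
    (μ : Fin (m + n) → K) (hμ : ∀ i s, φ (rowEnd K m n d i i s) = μ i * φ s)
    (hn : ∀ i j, j < i → ∀ s, φ (rowEnd K m n d i j s) = 0)
    (s : sections K m n d) : φ s = φ (baseSection K m n d) * evalBase K m n s := by
  obtain ⟨t, ht⟩ : ∃ s, φ s ≠ 0 := by
    by_contra! h0
    exact hφ (LinearMap.ext h0)
  choose k hkd hk using fun i => weight_nat i φ hφ (μ i) (hμ i)
  have hsum : ∑ i, (k i : ℤ) = m * d := by
    have h1 : ∑ i, rowEnd K m n d i i t = (m * d : K) • t := by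
      apply Subtype.ext
      simpa [rowEnd_coe] using sum_rowDer_sections t.2
    have h2 := congrArg φ h1
    rw [map_sum, map_smul, smul_eq_mul] at h2
    simp only [hμ, hk, ← Finset.sum_mul] at h2
    exact_mod_cast mul_right_cancel₀ ht h2
  have hcas : ∑ i, ∑ j, (if i = j then (k i : ℤ) * k i else if i < j then (k i : ℤ) - k j else 0)
      = m * d * (d + n) := by
    have h1 : ∑ i, ∑ j, rowEnd K m n d i j (rowEnd K m n d j i t)
        = ((m * d * (d + n) : ℕ) : K) • t := by
      apply Subtype.ext
      simpa only [AddSubmonoidClass.coe_finsetSum, rowEnd_coe, Submodule.coe_smul] using casimir_sections t.2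
    have h2 := congrArg φ h1
    simp only [map_sum, map_smul, smul_eq_mul] at h2
    -- For i > j the outer operator is raising and φ kills it. For i < j the commutator exchanges
    -- the two factors and leaves k_i - k_j.
    have h3 : ∀ i j, φ (rowEnd K m n d i j (rowEnd K m n d j i t))
        = (((if i = j then (k i : ℤ) * k i else if i < j then (k i : ℤ) - k j else 0 : ℤ)) : K)
          * φ t := by
      intro i j
      rcases lt_trichotomy i j with h | h | h
      · have e : rowEnd K m n d i j (rowEnd K m n d j i t)
            = rowEnd K m n d j i (rowEnd K m n d i j t) + rowEnd K m n d i i t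
              - rowEnd K m n d j j t := Subtype.ext (rowDer_comm i j (t : FrameRing K m n))
        rw [e, map_sub, map_add, hn j i h, hμ, hμ, hk, hk, if_neg h.ne, if_pos h]
        push_cast
        ring
      · subst h
        simp [hμ, hk, mul_assoc]
      · simp [hn i j h, h.ne', h.not_gt]
    simp only [h3, ← Finset.sum_mul] at h2
    have h4 := mul_right_cancel₀ ht h2
    have h5 : ((∑ i, ∑ j, (if i = j then (k i : ℤ) * k i else if i < j then (k i : ℤ) - k j
        else 0) : ℤ) : K) = ((m * d * (d + n) : ℤ) : K) := by
      simp only [Int.cast_sum]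
      rw [h4]
      push_cast
      rfl
    exact_mod_cast h5
  refine eq_evalBase_of_lower_weight_zero φ (fun i hi s => ?_) s
  have h0 := weight_eq_zero_of_casimir (fun i => (k i : ℤ)) (fun i => by positivity)
    (fun i => by exact_mod_cast hkd i) hsum hcas i hi
  have h0' : k i = 0 := by exact_mod_cast h0
  rw [hμ, hk, h0', Nat.cast_zero, zero_mul]

end BaseFrame

end GrassmannJet

namespace GrassmannJet

open MvPolynomial

/-! ### From 𝔰𝔩(V) to 𝔤𝔩(V), and the action of the parabolic. -/

section HighestWeight

variable {K : Type*} [Field K] {m n d : ℕ}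

theorem lie_VLam_apply (A : LieG K m n) (φ : VLam K m n d) (s : sections K m n d) :
    ⁅A, φ⁆ s = - φ ⁅A, s⁆ := rfl

theorem mem_lieG_iff {A : Matrix (Fin (m + n)) (Fin (m + n)) K} :
    A ∈ LieG K m n ↔ A.trace = 0 := Iff.rfl

theorem coe_lie_sections (A : LieG K m n) (s : sections K m n d) :
    ((⁅A, s⁆ : sections K m n d) : FrameRing K m n) = frameDer K m n A.1 s := rfl

theorem frameDer_one_sections {s : FrameRing K m n} (hs : s ∈ sections K m n d) :
    frameDer K m n 1 s = - ((m * d : K) • s) := by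
  rw [← sum_rowDer_sections hs, ← Finset.sum_neg_distrib]
  have e : (1 : Matrix (Fin (m + n)) (Fin (m + n)) K) = ∑ i, Matrix.single i i 1 := by
    ext i j
    rw [Matrix.sum_apply]
    rcases eq_or_ne i j with rfl | h
    · rw [Finset.sum_eq_single i] <;> simp +contextual
    · rw [Matrix.one_apply_ne h, eq_comm]
      refine Finset.sum_eq_zero fun k _ => ?_
      rw [Matrix.single_apply, if_neg]
      rintro ⟨rfl, rfl⟩
      exact h rfl
  have h : frameDer K m n 1 = - ∑ i, rowDer K m n i i := by
    rw [e]
    apply derivation_ext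
    rintro ⟨i, a⟩
    rw [frameDer_X, Derivation.neg_apply, derivation_sum_apply]
    simp only [rowDer_X, ← e, Matrix.one_apply]
    simp
  rw [h, Derivation.neg_apply, derivation_sum_apply, Finset.sum_neg_distrib]

theorem highestWeight_raising {v : VLam K m n d} (hv : IsHighestWeightVector (K := K) (m := m) (n := n) v)
    {i j : Fin (m + n)} (hij : j < i) (s : sections K m n d) : v (rowEnd K m n d i j s) = 0 := by
  let A : LieG K m n := ⟨Matrix.single j i 1, by
    rw [mem_lieG_iff]
    exact Matrix.trace_single_eq_of_ne _ _ _ hij.ne⟩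
  have h := hv.2.2 A (fun a b hab => by
    change Matrix.single j i (1 : K) a b = 0
    rw [Matrix.single_apply, if_neg]
    rintro ⟨rfl, rfl⟩
    exact absurd hij (not_lt.2 hab))
  have e : ⁅A, s⁆ = - rowEnd K m n d i j s := by
    apply Subtype.ext
    rw [coe_lie_sections]
    change frameDer K m n (Matrix.single j i 1) _ = _
    rw [frameDer_single]
    rfl
  have h2 := congrArg (fun φ : VLam K m n d => φ s) h
  simpa [lie_VLam_apply, e] using h2

theorem highestWeight_diagonal [CharZero K] {v : VLam K m n d} (hv : IsHighestWeightVector (K := K) (m := m) (n := n) v)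
    (i : Fin (m + n)) : ∃ c : K, ∀ s, v (rowEnd K m n d i i s) = c * v s := by
  obtain ⟨μ, hμ⟩ := hv.2.1
  have hN : ((m + n : ℕ) : K) ≠ 0 := by
    have := i.2
    exact_mod_cast (by omega : m + n ≠ 0)
  -- E_ii has trace 1, so its traceless part is used. The identity matrix acts on sections by the
  -- known scalar -md, which gives the correction term in the witness below.
  let A : LieG K m n := ⟨Matrix.single i i 1 - ((m + n : ℕ) : K)⁻¹ • 1, by
    rw [mem_lieG_iff]
    simp only [Matrix.trace_sub, Matrix.trace_smul, Matrix.trace_one, Fintype.card_fin,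
      smul_eq_mul, inv_mul_cancel₀ hN]
    simp⟩
  have hA : A ∈ cartan K m n := by
    intro a b hab
    change (Matrix.single i i (1 : K) - ((m + n : ℕ) : K)⁻¹ •
      (1 : Matrix (Fin (m + n)) (Fin (m + n)) K)) a b = 0
    rw [Matrix.sub_apply, Matrix.smul_apply, Matrix.one_apply_ne hab, Matrix.single_apply, if_neg]
    · simp
    · rintro ⟨rfl, rfl⟩
      exact hab rfl
  refine ⟨μ ⟨A, hA⟩ + ((m + n : ℕ) : K)⁻¹ * (m * d), fun s => ?_⟩
  have e : ⁅A, s⁆ = - rowEnd K m n d i i s + (((m + n : ℕ) : K)⁻¹ * (m * d)) • s := by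
    apply Subtype.ext
    rw [coe_lie_sections]
    change frameDer K m n (Matrix.single i i 1 - ((m + n : ℕ) : K)⁻¹ • 1) _ = _
    rw [sub_eq_add_neg, ← neg_smul, frameDer_add, frameDer_smul, Derivation.add_apply,
      Derivation.smul_apply, frameDer_one_sections s.2, frameDer_single, Derivation.neg_apply,
      neg_smul_neg, smul_smul]
    rfl
  have h2 := congrArg (fun φ : VLam K m n d => φ s) (hμ ⟨A, hA⟩)
  simp only [lie_VLam_apply, e, map_add, map_neg, map_smul, smul_eq_mul, LinearMap.smul_apply] at h2
  linear_combination h2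

/-- A highest weight vector of `V_λ` is a multiple of the evaluation at the base frame. -/
theorem IsHighestWeightVector.eq_evalBase [CharZero K] {v : VLam K m n d}
    (hv : IsHighestWeightVector (K := K) (m := m) (n := n) v) :
    ∃ c : K, c ≠ 0 ∧ ∀ s : sections K m n d, v s = c * evalBase K m n s := by
  choose μ hμ using highestWeight_diagonal hv
  have h := eq_evalBase_of_highest_weight v hv.1 μ hμ fun i j hij => highestWeight_raising hv hij
  refine ⟨v (baseSection K m n d), fun h0 => hv.1 (LinearMap.ext fun s => ?_), h⟩
  rw [h s, h0, zero_mul, LinearMap.zero_apply]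

/-- The block upper triangular matrices in `sl(V)`, the Lie algebra of `P`. -/
def parabolic (K : Type*) [Field K] (m n : ℕ) : Submodule K (LieG K m n) where
  carrier := {A | ∀ i j : Fin (m + n), m ≤ (i : ℕ) → (j : ℕ) < m → A.1 i j = 0}
  zero_mem' := fun _ _ _ _ => rfl
  add_mem' := by
    intro A B hA hB i j hi hj
    change A.1 i j + B.1 i j = 0
    rw [hA i j hi hj, hB i j hi hj, add_zero]
  smul_mem' := by
    intro c A hA i j hi hj
    change c * A.1 i j = 0
    rw [hA i j hi hj, mul_zero]

theorem evalBase_X (i : Fin (m + n)) (a : Fin m) :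
    evalBase K m n (X (i, a)) = if i = Fin.castAdd n a then 1 else 0 := by
  simp [evalBase]

theorem frameDer_apply (A : Matrix (Fin (m + n)) (Fin (m + n)) K) (f : FrameRing K m n) :
    frameDer K m n A f = - ∑ i, ∑ j, A j i • rowDer K m n i j f := by
  have h : frameDer K m n A = - ∑ i, ∑ j, A j i • rowDer K m n i j := by
    apply derivation_ext
    rintro ⟨k, a⟩
    rw [frameDer_X, Derivation.neg_apply, derivation_sum_apply]
    simp only [derivation_sum_apply, Derivation.smul_apply, rowDer_X]
    congr 1
    exact Finset.sum_congr rfl fun i _ => by simp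
  rw [h, Derivation.neg_apply, derivation_sum_apply]
  simp only [derivation_sum_apply, Derivation.smul_apply]

/-- At the base frame, row operations from the lower rows vanish, and a row operation among the
first m rows agrees with a column operation, which acts on sections by 0 or d. The only remaining
block of `A` is zero by assumption. -/
theorem evalBase_frameDer_parabolic {A : LieG K m n} (hA : A ∈ parabolic K m n)
    {s : FrameRing K m n} (hs : s ∈ sections K m n d) :
    evalBase K m n (frameDer K m n A.1 s)
      = (- ∑ a : Fin m, A.1 (Fin.castAdd n a) (Fin.castAdd n a) * d) * evalBase K m n s := by
  have hr : ∀ i j, evalBase K m n (rowDer K m n i j s)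
      = ∑ a, if i = Fin.castAdd n a then evalBase K m n (pderiv (j, a) s) else 0 := by
    intro i j
    rw [rowDer_apply, map_sum]
    refine Finset.sum_congr rfl fun a _ => ?_
    rw [map_mul, evalBase_X]
    split_ifs <;> simp
  have hlow : ∀ (i : Fin n) (j : Fin (m + n)), evalBase K m n (rowDer K m n (Fin.natAdd m i) j s) = 0 := by
    intro i j
    rw [hr]
    refine Finset.sum_eq_zero fun a _ => if_neg fun h => ?_
    have := congrArg Fin.val h
    simp only [Fin.val_natAdd, Fin.val_castAdd] at this
    omega
  have htop : ∀ a b : Fin m, evalBase K m n (rowDer K m n (Fin.castAdd n a) (Fin.castAdd n b) s)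
      = if a = b then d * evalBase K m n s else 0 := by
    intro a b
    have h1 : evalBase K m n (rowDer K m n (Fin.castAdd n a) (Fin.castAdd n b) s)
        = evalBase K m n (pderiv (Fin.castAdd n b, a) s) := by
      rw [hr, Finset.sum_eq_single a] <;> simp +contextual [eq_comm]
    have h2 : evalBase K m n (colDer K m n b a s)
        = evalBase K m n (pderiv (Fin.castAdd n b, a) s) := by
      rw [colDer_apply, map_sum, Finset.sum_eq_single (Fin.castAdd n b)] <;>
        simp +contextual [evalBase_X]
    rw [h1, ← h2, colDer_sections _ _ hs]
    rcases eq_or_ne a b with rfl | h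
    · simp
    · simp [h, h.symm]
  rw [frameDer_apply, map_neg, map_sum, neg_mul, Finset.sum_mul]
  congr 1
  have hz : ∀ i : Fin n, evalBase K m n
      (∑ j, A.1 j (Fin.natAdd m i) • rowDer K m n (Fin.natAdd m i) j s) = 0 := by
    intro i
    rw [map_sum]
    exact Finset.sum_eq_zero fun j _ => by rw [map_smul, hlow, smul_zero]
  rw [Fin.sum_univ_add, Finset.sum_eq_zero fun i _ => hz i, add_zero]
  refine Finset.sum_congr rfl fun a _ => ?_
  have hb : ∀ b : Fin n, evalBase K m n (A.1 (Fin.natAdd m b) (Fin.castAdd n a) •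
      rowDer K m n (Fin.castAdd n a) (Fin.natAdd m b) s) = 0 := by
    intro b
    rw [hA _ _ (by simp) (by simp), zero_smul, map_zero]
  rw [map_sum, Fin.sum_univ_add, Finset.sum_eq_zero fun b _ => hb b, add_zero]
  simp [htop, mul_assoc]

theorem lie_parabolic_highestWeight {v : VLam K m n d} {c : K}
    (hv : ∀ s : sections K m n d, v s = c * evalBase K m n s)
    {A : LieG K m n} (hA : A ∈ parabolic K m n) : ⁅A, v⁆ ∈ Submodule.span K {v} := by
  rw [Submodule.mem_span_singleton]
  refine ⟨∑ a : Fin m, A.1 (Fin.castAdd n a) (Fin.castAdd n a) * d, LinearMap.ext fun s => ?_⟩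
  rw [lie_VLam_apply, hv, coe_lie_sections, evalBase_frameDer_parabolic hA s.2,
    LinearMap.smul_apply, hv, smul_eq_mul]
  ring

end HighestWeight

end GrassmannJet

namespace GrassmannJet

/-! ### Exponent tuples and their number. -/

section Exponents

theorem exponent_induction {D : ℕ} {p : (Fin D → ℕ) → Prop} (h0 : p 0)
    (hs : ∀ e i, p e → p (e + Pi.single i 1)) (e : Fin D → ℕ) : p e := by
  induction h : ∑ i, e i generalizing e with
  | zero =>
    have : e = 0 := by
      ext i
      simpa using (Finset.sum_eq_zero_iff.1 h) i (Finset.mem_univ i)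
    rwa [this]
  | succ k ih =>
    obtain ⟨i, hi⟩ : ∃ i, e i ≠ 0 := by
      by_contra! h'
      simp [h'] at h
    have e1 : e = (e - Pi.single i 1) + Pi.single i 1 := by
      ext j
      rcases eq_or_ne j i with rfl | hj
      · simp only [Pi.add_apply, Pi.sub_apply, Pi.single_eq_same]
        omega
      · simp [hj]
    rw [e1]
    refine hs _ _ (ih _ ?_)
    rw [e1] at h
    simp only [Pi.add_apply, Finset.sum_add_distrib, Finset.sum_pi_single', Finset.mem_univ,
      if_true] at h
    omega

theorem sum_add_single {D : ℕ} (e : Fin D → ℕ) (i : Fin D) :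
    ∑ j, (e + Pi.single i 1 : Fin D → ℕ) j = ∑ j, e j + 1 := by
  simp [Finset.sum_add_distrib]

theorem mul_prod_ofFn_pow {M : Type*} [Monoid M] {D : ℕ} (x : Fin D → M)
    (hx : ∀ i j, Commute (x i) (x j)) (e : Fin D → ℕ) (i : Fin D) :
    x i * (List.ofFn fun j => x j ^ e j).prod
      = (List.ofFn fun j => x j ^ (e + Pi.single i 1 : Fin D → ℕ) j).prod := by
  induction D with
  | zero => exact i.elim0
  | succ D ih =>
    rw [List.ofFn_succ, List.ofFn_succ, List.prod_cons, List.prod_cons]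
    refine Fin.cases ?_ (fun i => ?_) i
    · rw [← mul_assoc, ← pow_succ']
      simp
    · rw [← mul_assoc, ((hx i.succ 0).pow_right _).eq, mul_assoc,
        ih (fun j => x j.succ) (fun _ _ => hx _ _) (fun j => e j.succ)]
      simp [Pi.single_apply]

/-- The number of monomials of degree at most `l` in `D` variables. -/
theorem card_exponents (D l : ℕ) :
    Nat.card {e : Fin D → ℕ // ∑ i, e i ≤ l} = (D + l).choose D := by
  -- The slack l - |e| becomes an extra coordinate, which reduces the count to multisets of size l
  -- from D + 1 elements.
  let E : {e : Fin D → ℕ // ∑ i, e i ≤ l} ≃ {f : Fin (D + 1) → ℕ // ∑ i, f i = l} :=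
    { toFun := fun e => ⟨Fin.cons (l - ∑ i, e.1 i) e.1, by
        have := e.2
        simp only [Fin.sum_univ_succ, Fin.cons_zero, Fin.cons_succ]
        omega⟩
      invFun := fun f => ⟨Fin.tail f.1, by
        have := f.2
        rw [Fin.sum_univ_succ] at this
        simp only [Fin.tail]
        omega⟩
      left_inv := fun e => by simp
      right_inv := fun f => by
        apply Subtype.ext
        refine (congrArg (fun a => (Fin.cons a (Fin.tail f.1) : Fin (D + 1) → ℕ)) ?_).trans
          (Fin.cons_self_tail f.1)
        have := f.2
        rw [Fin.sum_univ_succ] at this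
        simp only [Fin.tail]
        omega }
  rw [Nat.card_congr (E.trans (Sym.equivNatSumOfFintype (Fin (D + 1)) l).symm),
    Nat.card_eq_fintype_card, Sym.card_sym_eq_choose, Fintype.card_fin]
  rw [show D + 1 + l - 1 = D + l by omega, Nat.choose_symm_add]

end Exponents

/-! ### A PBW-type spanning argument for an abelian complement. -/

section Filtration

variable {K : Type*} [Field K] {L : Type*} [LieRing L] [LieAlgebra K L] {M : Type*}
  [AddCommGroup M] [Module K M] [LieRingModule L M] [LieModule K L M] {D : ℕ}

theorem envAct_ι (x : L) (w : M) : envAct K L M (UniversalEnvelopingAlgebra.ι K x) w = ⁅x, w⁆ := by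
  rw [envAct, UniversalEnvelopingAlgebra.lift_ι_apply]
  rfl

theorem ι_commute {x y : L} (h : ⁅x, y⁆ = 0) :
    Commute (UniversalEnvelopingAlgebra.ι K x) (UniversalEnvelopingAlgebra.ι K y) := by
  have := (UniversalEnvelopingAlgebra.ι K : L →ₗ⁅K⁆ _).map_lie x y
  rw [h, map_zero, LieRing.of_associative_ring_bracket, eq_comm, sub_eq_zero] at this
  exact this

theorem envMonomial_zero (z : Fin D → L) : envMonomial K z 0 = 1 := by
  simp [envMonomial]

theorem ι_mul_envMonomial (z : Fin D → L) (hz : ∀ i j, ⁅z i, z j⁆ = 0) (e : Fin D → ℕ)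
    (i : Fin D) : UniversalEnvelopingAlgebra.ι K (z i) * envMonomial K z e
      = envMonomial K z (e + Pi.single i 1) :=
  mul_prod_ofFn_pow _ (fun i j => ι_commute (hz i j)) e i

theorem lie_envMonomial (z : Fin D → L) (hz : ∀ i j, ⁅z i, z j⁆ = 0) (v : M) (e : Fin D → ℕ)
    (i : Fin D) : ⁅z i, envAct K L M (envMonomial K z e) v⁆
      = envAct K L M (envMonomial K z (e + Pi.single i 1)) v := by
  rw [← ι_mul_envMonomial z hz, map_mul, Module.End.mul_apply, envAct_ι]

theorem envMonomial_mem (z : Fin D → L) (hz : ∀ i j, ⁅z i, z j⁆ = 0) (e : Fin D → ℕ) :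
    envMonomial K z e ∈
      LinearMap.range (UniversalEnvelopingAlgebra.ι K : L →ₗ⁅K⁆ _).toLinearMap ^ (∑ i, e i) := by
  induction e using exponent_induction with
  | h0 =>
    rw [envMonomial_zero]
    simp only [Pi.zero_apply, Finset.sum_const_zero, pow_zero]
    exact Submodule.one_le.1 le_rfl
  | hs e i ih =>
    rw [← ι_mul_envMonomial z hz, sum_add_single, pow_succ']
    exact Submodule.mul_mem_mul ⟨z i, rfl⟩ ih

/-- The span of the vectors `z ^ e v` with `|e| ≤ l`. -/
def monomialSpan (K : Type*) [Field K] {L : Type*} [LieRing L] [LieAlgebra K L] {M : Type*}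
    [AddCommGroup M] [Module K M] [LieRingModule L M] [LieModule K L M] {D : ℕ}
    (z : Fin D → L) (v : M) (l : ℕ) : Submodule K M :=
  Submodule.span K (Set.range fun e : {e : Fin D → ℕ // ∑ i, e i ≤ l} =>
    envAct K L M (envMonomial K z e.1) v)

theorem mem_monomialSpan (z : Fin D → L) (v : M) {l : ℕ} {e : Fin D → ℕ} (he : ∑ i, e i ≤ l) :
    envAct K L M (envMonomial K z e) v ∈ monomialSpan K z v l :=
  Submodule.subset_span ⟨⟨e, he⟩, rfl⟩

theorem monomialSpan_mono (z : Fin D → L) (v : M) {l k : ℕ} (h : l ≤ k) :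
    monomialSpan K z v l ≤ monomialSpan K z v k := by
  refine Submodule.span_le.2 ?_
  rintro _ ⟨e, rfl⟩
  exact mem_monomialSpan z v (e.2.trans h)

theorem lie_mem_monomialSpan (z : Fin D → L) (hz : ∀ i j, ⁅z i, z j⁆ = 0) (v : M) {l : ℕ}
    {w : M} (hw : w ∈ monomialSpan K z v l) {x : L} (hx : x ∈ Submodule.span K (Set.range z)) :
    ⁅x, w⁆ ∈ monomialSpan K z v (l + 1) := by
  induction hx using Submodule.span_induction with
  | mem x hx =>
    obtain ⟨i, rfl⟩ := hx
    induction hw using Submodule.span_induction with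
    | mem w hw =>
      obtain ⟨e, rfl⟩ := hw
      change ⁅z i, envAct K L M (envMonomial K z e.1) v⁆ ∈ _
      rw [lie_envMonomial z hz]
      exact mem_monomialSpan z v (by rw [sum_add_single]; exact Nat.succ_le_succ e.2)
    | zero => simp
    | add a b _ _ ha hb => rw [lie_add]; exact Submodule.add_mem _ ha hb
    | smul c a _ ha => rw [lie_smul]; exact Submodule.smul_mem _ _ ha
  | zero => simp
  | add a b _ _ ha hb => rw [add_lie]; exact Submodule.add_mem _ ha hb
  | smul c a _ ha => rw [smul_lie]; exact Submodule.smul_mem _ _ ha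

/-- If `L` is spanned by the commuting `z i` and a subspace `p` that preserves the line of `v`, then
`p` preserves the span of the `z ^ e v` with `|e| ≤ l`. -/
theorem lie_complement_mem_monomialSpan (z : Fin D → L) (hz : ∀ i j, ⁅z i, z j⁆ = 0)
    (p : Submodule K L) (hp : Submodule.span K (Set.range z) ⊔ p = ⊤) (v : M)
    (hv : ∀ y ∈ p, ⁅y, v⁆ ∈ Submodule.span K {v}) (l : ℕ) {w : M}
    (hw : w ∈ monomialSpan K z v l) {y : L} (hy : y ∈ p) :
    ⁅y, w⁆ ∈ monomialSpan K z v l := by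
  have h0 : ∀ l, ∀ y ∈ p, ⁅y, v⁆ ∈ monomialSpan K z v l := by
    intro l y hy
    refine Submodule.span_le.2 ?_ (hv y hy)
    rw [Set.singleton_subset_iff]
    have := mem_monomialSpan (K := K) z v (l := l) (e := 0) (by simp)
    simpa [envMonomial_zero] using this
  have key : ∀ (e : Fin D → ℕ) (y : L), y ∈ p → ∀ l, ∑ i, e i ≤ l →
      ⁅y, envAct K L M (envMonomial K z e) v⁆ ∈ monomialSpan K z v l := by
    intro e
    induction e using exponent_induction with
    | h0 =>
      intro y hy l _
      simpa [envMonomial_zero] using h0 l y hy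
    | hs e i ih =>
      intro y hy l hl
      rw [sum_add_single] at hl
      obtain ⟨l, rfl⟩ : ∃ k, l = k + 1 := ⟨l - 1, by omega⟩
      have hl' : ∑ i, e i ≤ l := Nat.succ_le_succ_iff.1 hl
      rw [← lie_envMonomial z hz, leibniz_lie]
      -- In y z_i w = [y, z_i] w + z_i y w the commutator splits along span(z) + p: the first part
      -- raises the degree of w by one, which is allowed, and the second falls under the induction
      -- hypothesis, as does y w.
      refine Submodule.add_mem _ ?_ ?_
      · obtain ⟨a, ha, b, hb, hab⟩ := Submodule.mem_sup.1 (hp ▸ Submodule.mem_top : ⁅y, z i⁆ ∈ _ ⊔ p)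
        rw [← hab, add_lie]
        exact Submodule.add_mem _ (lie_mem_monomialSpan z hz v (mem_monomialSpan z v hl') ha)
          (ih b hb _ (hl'.trans (Nat.le_succ l)))
      · exact lie_mem_monomialSpan z hz v (ih y hy l hl') (Submodule.subset_span ⟨i, rfl⟩)
  induction hw using Submodule.span_induction with
  | mem w hw =>
    obtain ⟨e, rfl⟩ := hw
    exact key e.1 y hy l e.2
  | zero => simp
  | add a b _ _ ha hb => rw [lie_add]; exact Submodule.add_mem _ ha hb
  | smul c a _ ha => rw [lie_smul]; exact Submodule.smul_mem _ _ ha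

/-- Under the same hypotheses, `U_l(L) v` is spanned by the `z ^ e v` with `|e| ≤ l`. -/
theorem canonicalFiltration_eq_monomialSpan (z : Fin D → L) (hz : ∀ i j, ⁅z i, z j⁆ = 0)
    (p : Submodule K L) (hp : Submodule.span K (Set.range z) ⊔ p = ⊤) (v : M)
    (hv : ∀ y ∈ p, ⁅y, v⁆ ∈ Submodule.span K {v}) (l : ℕ) :
    canonicalFiltration K L v l = monomialSpan K z v l := by
  apply le_antisymm
  · rw [canonicalFiltration, envFiltration, Submodule.map_iSup]
    refine iSup_le fun ⟨k, hk⟩ => ?_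
    refine le_trans ?_ (monomialSpan_mono z v (Nat.lt_succ_iff.1 hk))
    rintro _ ⟨x, hx, rfl⟩
    change envAct K L M x v ∈ _
    replace hx : x ∈
      LinearMap.range (UniversalEnvelopingAlgebra.ι K : L →ₗ⁅K⁆ _).toLinearMap ^ k := hx
    clear hk
    induction k generalizing x with
    | zero =>
      rw [pow_zero, Submodule.mem_one] at hx
      obtain ⟨c, rfl⟩ := hx
      rw [AlgHom.commutes, Module.algebraMap_end_apply]
      refine Submodule.smul_mem _ _ ?_
      have := mem_monomialSpan (K := K) z v (l := 0) (e := 0) (by simp)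
      simpa [envMonomial_zero] using this
    | succ k ih =>
      rw [pow_succ'] at hx
      induction hx using Submodule.mul_induction_on' with
      | mem_mul_mem a ha b hb =>
        obtain ⟨y, rfl⟩ := ha
        rw [map_mul, Module.End.mul_apply]
        change envAct K L M (UniversalEnvelopingAlgebra.ι K y) _ ∈ _
        rw [envAct_ι]
        -- Only the component of y in span(z) raises the degree; the component in `p` preserves each
        -- step of the filtration.
        obtain ⟨s, hs, t, ht, hst⟩ := Submodule.mem_sup.1 (hp ▸ Submodule.mem_top : y ∈ _ ⊔ p)
        rw [← hst, add_lie]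
        exact Submodule.add_mem _ (lie_mem_monomialSpan z hz v (ih b hb) hs)
          (monomialSpan_mono z v (Nat.le_succ k)
            (lie_complement_mem_monomialSpan z hz p hp v hv k (ih b hb) ht))
      | add a _ b _ ha hb => rw [map_add, LinearMap.add_apply]; exact Submodule.add_mem _ ha hb
  · refine Submodule.span_le.2 ?_
    rintro _ ⟨e, rfl⟩
    exact ⟨envMonomial K z e.1, Submodule.mem_iSup_of_mem ⟨∑ i, e.1 i, Nat.lt_succ_of_le e.2⟩
      (envMonomial_mem z hz e.1), rfl⟩

end Filtration

end GrassmannJet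

namespace GrassmannJet

open MvPolynomial

/-! ### The pairing of the vectors z^e v with sections on the big cell. -/

section Pairing

variable {K : Type*} [Field K] {m n d : ℕ}

theorem lie_nil_eq_zero (A B : nil K m n) : ⁅(A : LieG K m n), (B : LieG K m n)⁆ = 0 := by
  have key : ∀ A B : nil K m n, A.1.1 * B.1.1 = 0 := by
    intro A B
    ext i j
    rw [Matrix.mul_apply]
    refine Finset.sum_eq_zero fun k _ => ?_
    by_cases h : (k : ℕ) < m
    · rw [B.2 k j (by omega), mul_zero]
    · rw [A.2 i k (by omega), zero_mul]
  apply Subtype.ext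
  change A.1.1 * B.1.1 - B.1.1 * A.1.1 = 0
  rw [key, key, sub_zero]

theorem nil_sup_parabolic : (nil K m n).toSubmodule ⊔ parabolic K m n = ⊤ := by
  rw [eq_top_iff]
  rintro A -
  let B : Matrix (Fin (m + n)) (Fin (m + n)) K :=
    Matrix.of fun i j => if m ≤ (i : ℕ) ∧ (j : ℕ) < m then A.1 i j else 0
  have hB : B ∈ LieG K m n := by
    rw [mem_lieG_iff]
    exact Finset.sum_eq_zero fun i _ => if_neg (by omega)
  have hBn : (⟨B, hB⟩ : LieG K m n) ∈ (nil K m n).toSubmodule := fun i j hij => if_neg hij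
  refine Submodule.mem_sup.2 ⟨⟨B, hB⟩, hBn, A - ⟨B, hB⟩, fun i j hi hj => ?_, by simp⟩
  change A.1 i j - B i j = 0
  rw [sub_eq_zero]
  exact (if_pos ⟨hi, hj⟩).symm

/-- The elementary matrix in `n` at the given place. -/
def nilSingle (K : Type*) [Field K] (m n : ℕ) (k : Fin n) (a : Fin m) : nil K m n :=
  ⟨⟨Matrix.single (Fin.natAdd m k) (Fin.castAdd n a) 1, by
    rw [mem_lieG_iff]
    refine Matrix.trace_single_eq_of_ne _ _ _ fun h => ?_
    have := congrArg Fin.val h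
    simp only [Fin.val_natAdd, Fin.val_castAdd] at this
    omega⟩, fun i j hij => by
    change Matrix.single (Fin.natAdd m k) (Fin.castAdd n a) (1 : K) i j = 0
    rw [Matrix.single_apply, if_neg]
    rintro ⟨rfl, rfl⟩
    simp at hij⟩

variable (K m n) in
/-- The coordinates on `n`. -/
noncomputable def nilEquiv : nil K m n ≃ₗ[K] (Fin n × Fin m → K) where
  toFun A p := A.1.1 (Fin.natAdd m p.1) (Fin.castAdd n p.2)
  map_add' _ _ := rfl
  map_smul' _ _ := rfl
  invFun y := ∑ p, y p • nilSingle K m n p.1 p.2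
  left_inv A := by
    apply Subtype.ext
    apply Subtype.ext
    rw [AddSubmonoidClass.coe_finsetSum, AddSubmonoidClass.coe_finsetSum]
    ext i j
    rw [Matrix.sum_apply]
    change ∑ p : Fin n × Fin m, A.1.1 (Fin.natAdd m p.1) (Fin.castAdd n p.2) *
      Matrix.single (Fin.natAdd m p.1) (Fin.castAdd n p.2) (1 : K) i j = _
    by_cases h : m ≤ (i : ℕ) ∧ (j : ℕ) < m
    · obtain ⟨k, rfl⟩ : ∃ k : Fin n, Fin.natAdd m k = i :=
        ⟨⟨i - m, by omega⟩, Fin.ext (by simp; omega)⟩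
      obtain ⟨a, rfl⟩ : ∃ a : Fin m, Fin.castAdd n a = j := ⟨⟨j, h.2⟩, rfl⟩
      rw [Finset.sum_eq_single (k, a)]
      · simp
      · rintro ⟨k', a'⟩ _ hne
        rw [Matrix.single_apply, if_neg, mul_zero]
        rintro ⟨h1, h2⟩
        exact hne (Prod.ext (Fin.natAdd_injective _ _ h1) (Fin.castAdd_injective _ _ h2))
      · simp
    · rw [A.2 i j h]
      refine Finset.sum_eq_zero fun p _ => ?_
      rw [Matrix.single_apply, if_neg, mul_zero]
      rintro ⟨rfl, rfl⟩
      simp at h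
  right_inv y := by
    ext ⟨k, a⟩
    change ((∑ p, y p • nilSingle K m n p.1 p.2 : nil K m n) : LieG K m n).1 _ _ = _
    rw [AddSubmonoidClass.coe_finsetSum, AddSubmonoidClass.coe_finsetSum, Matrix.sum_apply]
    change ∑ p : Fin n × Fin m, y p *
      Matrix.single (Fin.natAdd m p.1) (Fin.castAdd n p.2) (1 : K) (Fin.natAdd m k)
        (Fin.castAdd n a) = _
    rw [Finset.sum_eq_single (k, a)]
    · simp
    · rintro ⟨k', a'⟩ _ hne
      rw [Matrix.single_apply, if_neg, mul_zero]
      rintro ⟨h1, h2⟩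
      exact hne (Prod.ext (Fin.natAdd_injective _ _ h1) (Fin.castAdd_injective _ _ h2))
    · simp

/-- A basis of `n` indexed by `Fin (m * n)`. -/
noncomputable def nilBasis (K : Type*) [Field K] (m n : ℕ) :
    Module.Basis (Fin (m * n)) K (nil K m n) :=
  (Module.Basis.ofEquivFun (nilEquiv K m n)).reindex
    (Fintype.equivOfCardEq (by simp [mul_comm]))

/-- A matrix in 𝔫 changes only the lower rows of a frame, and p_0 does not involve them. -/
theorem frameDer_nil_basePlucker (A : nil K m n) :
    frameDer K m n A.1.1 (basePlucker K m n) = 0 := by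
  rw [basePlucker, plucker, derivation_det_updateRow]
  refine Finset.sum_eq_zero fun b _ => Matrix.det_eq_zero_of_row_eq_zero b fun a => ?_
  rw [Matrix.updateRow_self, Matrix.of_apply, frameDer_X, Finset.sum_eq_zero, neg_zero]
  intro k _
  rw [A.2 _ _ (by simp), zero_smul]

variable (K m n) in
/-- The Plücker coordinate with the `a`-th base row replaced by the `k`-th lower row. -/
noncomputable def nextPlucker (k : Fin n) (a : Fin m) : FrameRing K m n :=
  plucker K m n (Function.update (Fin.castAdd n) a (Fin.natAdd m k))

theorem evalBase_nextPlucker (k : Fin n) (a : Fin m) : evalBase K m n (nextPlucker K m n k a) = 0 := by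
  rw [nextPlucker, plucker, AlgHom.map_det]
  refine Matrix.det_eq_zero_of_row_eq_zero a fun b => ?_
  rw [AlgHom.mapMatrix_apply, Matrix.map_apply, Matrix.of_apply, evalBase_X, if_neg]
  intro h
  have := congrArg Fin.val h
  simp only [Function.update_self, Fin.val_natAdd, Fin.val_castAdd] at this
  omega

/-- The lower row k becomes a combination of the first m rows. All of these except row a already
occur in the minor, so only the a-th term survives and it restores p_0. -/
theorem frameDer_nil_nextPlucker (A : nil K m n) (k : Fin n) (a : Fin m) :
    frameDer K m n A.1.1 (nextPlucker K m n k a)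
      = - (A.1.1 (Fin.natAdd m k) (Fin.castAdd n a) • basePlucker K m n) := by
  set M : Matrix (Fin m) (Fin m) (FrameRing K m n) :=
    Matrix.of fun c b => X (Fin.castAdd n c, b) with hM
  set N : Matrix (Fin m) (Fin m) (FrameRing K m n) :=
    Matrix.of fun c b => X (Function.update (Fin.castAdd n) a (Fin.natAdd m k) c, b) with hN
  have hrow : (N.updateRow a fun i => frameDer K m n A.1.1 (N a i))
      = M.updateRow a (∑ c, (C (-A.1.1 (Fin.natAdd m k) (Fin.castAdd n c)) : FrameRing K m n) • M c) := by
    ext1 c b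
    rcases eq_or_ne c a with rfl | h
    · rw [Matrix.updateRow_self, Matrix.updateRow_self, hN, Matrix.of_apply, Function.update_self,
        frameDer_X, Fin.sum_univ_add, Finset.sum_apply]
      rw [Finset.sum_eq_zero (s := (Finset.univ : Finset (Fin n))), add_zero,
        ← Finset.sum_neg_distrib]
      · refine Finset.sum_congr rfl fun j _ => ?_
        rw [Pi.smul_apply, smul_eq_mul, C_mul', neg_smul]
        rfl
      · intro j _
        rw [A.2 _ _ (by simp), zero_smul]
    · rw [Matrix.updateRow_ne h, Matrix.updateRow_ne h, hN, hM, Matrix.of_apply, Matrix.of_apply,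
        Function.update_of_ne h]
  rw [nextPlucker, plucker, derivation_det_updateRow, Finset.sum_eq_single a]
  · change (N.updateRow a fun i => frameDer K m n A.1.1 (N a i)).det = _
    rw [hrow, Matrix.det_updateRow_sum, smul_eq_mul, C_mul', neg_smul]
    rfl
  · intro c _ hc
    refine Matrix.det_eq_zero_of_row_eq_zero c fun b => ?_
    rw [Matrix.updateRow_self, Matrix.of_apply, Function.update_of_ne hc, frameDer_X,
      Finset.sum_eq_zero, neg_zero]
    intro j _
    rw [A.2 _ _ (by simp), zero_smul]
  · simp

variable (z : Module.Basis (Fin (m * n)) K (nil K m n))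

/-- The combinations of Plücker coordinates dual to a basis of `n`. -/
noncomputable def dualPlucker (j : Fin (m * n)) : FrameRing K m n :=
  ∑ p : Fin n × Fin m, z.coord j (nilSingle K m n p.1 p.2) • nextPlucker K m n p.1 p.2

theorem dualPlucker_mem (j : Fin (m * n)) : dualPlucker z j ∈ pluckerSpan K m n :=
  Submodule.sum_mem _ fun _ _ => Submodule.smul_mem _ _ (plucker_mem _)

theorem evalBase_dualPlucker (j : Fin (m * n)) : evalBase K m n (dualPlucker z j) = 0 := by
  rw [dualPlucker, map_sum]
  exact Finset.sum_eq_zero fun p _ => by rw [map_smul, evalBase_nextPlucker, smul_zero]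

theorem frameDer_dualPlucker (i j : Fin (m * n)) :
    frameDer K m n (z i).1.1 (dualPlucker z j)
      = if i = j then - basePlucker K m n else 0 := by
  have h : z.coord j (z i) = ∑ p : Fin n × Fin m,
      (z i).1.1 (Fin.natAdd m p.1) (Fin.castAdd n p.2) * z.coord j (nilSingle K m n p.1 p.2) := by
    conv_lhs => rw [← (nilEquiv K m n).symm_apply_apply (z i)]
    change z.coord j (∑ p : Fin n × Fin m, (z i).1.1 (Fin.natAdd m p.1) (Fin.castAdd n p.2) •
      nilSingle K m n p.1 p.2) = _
    rw [map_sum]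
    simp only [map_smul, smul_eq_mul]
  have h2 : frameDer K m n (z i).1.1 (dualPlucker z j)
      = - (z.coord j (z i) • basePlucker K m n) := by
    rw [dualPlucker, map_sum, h, Finset.sum_smul, ← Finset.sum_neg_distrib]
    refine Finset.sum_congr rfl fun p _ => ?_
    rw [Derivation.map_smul, frameDer_nil_nextPlucker, smul_neg, smul_smul, mul_comm]
  rw [h2, Module.Basis.coord_apply, Module.Basis.repr_self, Finsupp.single_apply]
  split_ifs <;> simp

/-- The products of the dual Plücker coordinates with a power of `p_0`. -/
noncomputable def dualMonomial (k : ℕ) (f : Fin (m * n) → ℕ) : FrameRing K m n :=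
  basePlucker K m n ^ k * ∏ j, dualPlucker z j ^ f j

theorem dualMonomial_mem (k : ℕ) (f : Fin (m * n) → ℕ) :
    dualMonomial z k f ∈ pluckerSpan K m n ^ (k + ∑ j, f j) := by
  rw [dualMonomial, pow_add, ← Finset.prod_pow_eq_pow_sum]
  refine Submodule.mul_mem_mul (Submodule.pow_mem_pow _ (plucker_mem _) k) ?_
  induction (Finset.univ : Finset (Fin (m * n))) using Finset.induction_on with
  | empty =>
    rw [Finset.prod_empty, Finset.prod_empty]
    exact Submodule.one_le.1 le_rfl
  | insert a s ha ih =>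
    rw [Finset.prod_insert ha, Finset.prod_insert ha]
    exact Submodule.mul_mem_mul (Submodule.pow_mem_pow _ (dualPlucker_mem z a) _) ih

theorem evalBase_dualMonomial (k : ℕ) (f : Fin (m * n) → ℕ) :
    evalBase K m n (dualMonomial z k f) = if f = 0 then 1 else 0 := by
  rw [dualMonomial, map_mul, map_pow, evalBase_basePlucker, one_pow, one_mul, map_prod]
  split_ifs with h
  · subst h
    simp
  · obtain ⟨i, hi⟩ : ∃ i, f i ≠ 0 := by
      by_contra! h0
      exact h (funext h0)
    refine Finset.prod_eq_zero (Finset.mem_univ i) ?_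
    rw [map_pow, evalBase_dualPlucker, zero_pow hi]

/-- On these monomials z_i acts as -p_0 ∂/∂q_i, where q_i is the i-th dual coordinate. If `f i = 0`
the truncated subtraction is harmless, since the coefficient vanishes. -/
theorem frameDer_dualMonomial (i : Fin (m * n)) (k : ℕ) (f : Fin (m * n) → ℕ) :
    frameDer K m n (z i).1.1 (dualMonomial z k f)
      = - ((f i : K) • dualMonomial z (k + 1) (f - Pi.single i 1)) := by
  have hrest : frameDer K m n (z i).1.1 (basePlucker K m n ^ k *
      ∏ j ∈ Finset.univ.erase i, dualPlucker z j ^ f j) = 0 := by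
    rw [Derivation.leibniz, Derivation.leibniz_pow, frameDer_nil_basePlucker, derivation_prod,
      Finset.sum_eq_zero]
    · simp
    · intro j hj
      rw [Derivation.leibniz_pow, frameDer_dualPlucker, if_neg (Finset.ne_of_mem_erase hj).symm]
      simp
  have e : ∀ (k : ℕ) (g : Fin (m * n) → ℕ), dualMonomial z k g = (basePlucker K m n ^ k *
      ∏ j ∈ Finset.univ.erase i, dualPlucker z j ^ g j) * dualPlucker z i ^ g i := by
    intro k g
    rw [dualMonomial, mul_assoc, Finset.prod_erase_mul _ _ (Finset.mem_univ i)]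
  have e2 : ∏ j ∈ Finset.univ.erase i, dualPlucker z j ^ (f - Pi.single i 1 : Fin (m * n) → ℕ) j
      = ∏ j ∈ Finset.univ.erase i, dualPlucker z j ^ f j := by
    refine Finset.prod_congr rfl fun j hj => ?_
    simp [Finset.ne_of_mem_erase hj]
  rw [e k f, Derivation.leibniz, hrest, Derivation.leibniz_pow, frameDer_dualPlucker, if_pos rfl,
    e (k + 1), e2, Pi.sub_apply, Pi.single_eq_same]
  simp only [smul_eq_mul, Algebra.smul_def, map_natCast, eq_natCast]
  ring

theorem prod_factorial_add_single {D : ℕ} (e : Fin D → ℕ) (i : Fin D) :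
    ∏ j, (((e + Pi.single i 1 : Fin D → ℕ) j).factorial : K)
      = (e i + 1) * ∏ j, ((e j).factorial : K) := by
  rw [← Finset.mul_prod_erase _ _ (Finset.mem_univ i),
    ← Finset.mul_prod_erase _ (fun j => ((e j).factorial : K)) (Finset.mem_univ i), ← mul_assoc]
  congr 1
  · simp [Nat.factorial_succ]
  · exact Finset.prod_congr rfl fun j hj => by simp [Finset.ne_of_mem_erase hj]

/-- The vectors `z ^ e v` pair diagonally with the dual monomials. -/
theorem envMonomial_dualMonomial [CharZero K] {v : VLam K m n d} {c : K}
    (hv : ∀ s : sections K m n d, v s = c * evalBase K m n s) (e : Fin (m * n) → ℕ)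
    (f : Fin (m * n) → ℕ) (k : ℕ) (s : sections K m n d) (hs : s.1 = dualMonomial z k f) :
    envAct K (LieG K m n) (VLam K m n d)
        (envMonomial K (fun i => (z i : LieG K m n)) e) v s
      = if e = f then c * ∏ i, ((e i).factorial : K) else 0 := by
  -- Each z_i trades a factor q_i for a factor p_0, so `f`, the power `k` and the section must all
  -- vary. The minus sign of the contragredient action cancels that of the derivation, leaving the
  -- positive factor f_i, and these factors accumulate to factorials.
  induction e using exponent_induction generalizing f k s with
  | h0 =>
    rw [envMonomial_zero, map_one, Module.End.one_apply, hv, hs, evalBase_dualMonomial]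
    simp [eq_comm]
  | hs e i ih =>
    rw [← lie_envMonomial _ (fun i j => lie_nil_eq_zero (z i) (z j)), lie_VLam_apply]
    have hl : ((⁅(z i : LieG K m n), s⁆ : sections K m n d) : FrameRing K m n)
        = - ((f i : K) • dualMonomial z (k + 1) (f - Pi.single i 1)) := by
      rw [coe_lie_sections, hs, frameDer_dualMonomial]
    by_cases hf : f i = 0
    · have h0 : ⁅(z i : LieG K m n), s⁆ = 0 := by
        apply Subtype.ext
        rw [hl, hf]
        simp
      rw [h0, map_zero, neg_zero, if_neg]
      intro h
      have := congrFun h i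
      simp [hf] at this
    · have hfK : (f i : K) ≠ 0 := by exact_mod_cast hf
      have ht : ((-((f i : K)⁻¹ • ⁅(z i : LieG K m n), s⁆) : sections K m n d) : FrameRing K m n)
          = dualMonomial z (k + 1) (f - Pi.single i 1) := by
        rw [Submodule.coe_neg, Submodule.coe_smul, hl, smul_neg, neg_neg, smul_smul,
          inv_mul_cancel₀ hfK, one_smul]
      have h1 := ih _ _ _ ht
      have hsub : f = (f - Pi.single i 1) + Pi.single i 1 := by
        ext j
        rcases eq_or_ne j i with rfl | hj
        · simp only [Pi.add_apply, Pi.sub_apply, Pi.single_eq_same]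
          omega
        · simp [hj]
      have hiff : e + Pi.single i 1 = f ↔ e = f - Pi.single i 1 := by
        constructor
        · rintro rfl
          simp
        · intro h
          rw [h, ← hsub]
      rw [map_neg, map_smul, smul_eq_mul] at h1
      have h2 : ∀ y r : K, -((f i : K)⁻¹ * y) = r → -y = f i * r := by
        rintro y _ rfl
        field_simp
      rw [h2 _ _ h1, mul_ite, mul_zero]
      simp only [hiff]
      split_ifs with h
      · have hfi : f i = e i + 1 := by rw [hsub, ← h]; simp
        rw [prod_factorial_add_single, hfi]
        push_cast
        ring
      · rfl

end Pairing

/-! ### Linear independence, spanning and the dimension. -/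

section Main

variable {K : Type*} [Field K] {m n d : ℕ}

theorem linearIndependent_envMonomial [CharZero K] (z : Module.Basis (Fin (m * n)) K (nil K m n))
    {v : VLam K m n d} {c : K} (hc : c ≠ 0)
    (hv : ∀ s : sections K m n d, v s = c * evalBase K m n s) {l : ℕ} (hld : l ≤ d) :
    LinearIndependent K fun e : {e : Fin (m * n) → ℕ // ∑ i, e i ≤ l} =>
      envAct K (LieG K m n) (VLam K m n d)
        (envMonomial K (fun i => (z i : LieG K m n)) e.1) v := by
  rw [linearIndependent_iff']
  intro S g hg f hf
  -- The factor p_0^(d-|f|) brings the test monomial to degree exactly d; the subtraction is not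
  -- truncated because |f| ≤ l ≤ d.
  have hs : dualMonomial z (d - ∑ i, f.1 i) f.1 ∈ sections K m n d := by
    have h := dualMonomial_mem z (d - ∑ i, f.1 i) f.1
    rw [Nat.sub_add_cancel (f.2.trans hld)] at h
    exact pluckerSpan_pow_le_sections h
  have h := congrArg (fun φ : VLam K m n d => φ ⟨_, hs⟩) hg
  simp only [LinearMap.sum_apply, LinearMap.smul_apply, LinearMap.zero_apply, smul_eq_mul,
    envMonomial_dualMonomial z hv _ _ _ ⟨_, hs⟩ rfl] at h
  rw [Finset.sum_eq_single f, if_pos rfl, mul_eq_zero, or_iff_left] at h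
  · exact h
  · exact mul_ne_zero hc (Finset.prod_ne_zero_iff.2 fun i _ => by
      exact_mod_cast Nat.factorial_ne_zero _)
  · intro e _ he
    rw [if_neg fun h => he (Subtype.ext h), mul_zero]
  · exact fun h => absurd hf h

theorem canonicalFiltration_eq (z : Module.Basis (Fin (m * n)) K (nil K m n))
    {v : VLam K m n d} {c : K} (hv : ∀ s : sections K m n d, v s = c * evalBase K m n s) (l : ℕ) :
    canonicalFiltration K (LieG K m n) v l
      = monomialSpan K (fun i => (z i : LieG K m n)) v l := by
  refine canonicalFiltration_eq_monomialSpan _ (fun i j => lie_nil_eq_zero (z i) (z j))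
    (parabolic K m n) ?_ v (fun y hy => lie_parabolic_highestWeight hv hy) l
  rw [← nil_sup_parabolic]
  congr 1
  have h := congrArg (Submodule.map (nil K m n).toSubmodule.subtype) z.span_eq
  rw [Submodule.map_span, Submodule.map_top, Submodule.range_subtype, ← Set.range_comp] at h
  exact h

end Main

end GrassmannJet

theorem corollary4p9 (K : Type*) [Field K] [CharZero K] (m n d l : ℕ) (hl : 1 ≤ l) (hld : l < d)
    (v : GrassmannJet.VLam K m n d)
    (hv : GrassmannJet.IsHighestWeightVector (K := K) (m := m) (n := n) v) :
    (∀ z : Module.Basis (Fin (m * n)) K (GrassmannJet.nil K m n),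
      ∃ b : Module.Basis {e : Fin (m * n) → ℕ // ∑ i, e i ≤ l} K
          (GrassmannJet.canonicalFiltration K (GrassmannJet.LieG K m n) v l),
        ∀ e, (b e : GrassmannJet.VLam K m n d) =
          GrassmannJet.envAct K (GrassmannJet.LieG K m n) (GrassmannJet.VLam K m n d)
            (GrassmannJet.envMonomial K (fun i => (z i : GrassmannJet.LieG K m n)) e.1) v) ∧
    Module.finrank K (GrassmannJet.canonicalFiltration K (GrassmannJet.LieG K m n) v l) =
      (m * n + l).choose (m * n) := by
  obtain ⟨c, hc, hvc⟩ := hv.eq_evalBase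
  have h : ∀ z : Module.Basis (Fin (m * n)) K (GrassmannJet.nil K m n),
      ∃ b : Module.Basis {e : Fin (m * n) → ℕ // ∑ i, e i ≤ l} K
          (GrassmannJet.canonicalFiltration K (GrassmannJet.LieG K m n) v l),
        ∀ e, (b e : GrassmannJet.VLam K m n d) =
          GrassmannJet.envAct K (GrassmannJet.LieG K m n) (GrassmannJet.VLam K m n d)
            (GrassmannJet.envMonomial K (fun i => (z i : GrassmannJet.LieG K m n)) e.1) v := by
    intro z
    rw [GrassmannJet.canonicalFiltration_eq z hvc l]
    exact ⟨Module.Basis.span (GrassmannJet.linearIndependent_envMonomial z hc hvc hld.le),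
      fun e => Module.Basis.coe_span_apply _ e⟩
  refine ⟨h, ?_⟩
  obtain ⟨b, -⟩ := h (GrassmannJet.nilBasis K m n)
  rw [Module.finrank_eq_nat_card_basis b, GrassmannJet.card_exponents]
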